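/- Conventions. All spaces are complex, scalar matrices in $M_{m,n}=M_{m,n}(\mathbb C)$ carry the operator norm $\ell^2_n\to\ell^2_m$, and $E^*$ is the Banach space dual of $E$. An operator space over a Banach space $E$ is a family of norms on the spaces $M_n(E)$, $n\in\mathbb N$, such that $M_1(E)=E$ isometrically, $\|x\oplus y\|_{M_{m+n}(E)}=\max\{\|x\|_{M_m(E)},\|y\|_{M_n(E)}\}$ and $\|\alpha x\beta\|_{M_n(E)}\le\|\alpha\|\,\|x\|_{M_m(E)}\,\|\beta\|$ for $x\in M_m(E)$, $y\in M_n(E)$ (in the first condition), $\alpha\in M_{n,m}$, $\beta\in M_{m,n}$. For a linear map $T$ between operator spaces, $\|T\|_{cb}:=\sup_n\|T_n\|\in[0,\infty]$, where $T_n$ applies $T$ to each entry of an $n\times n$ matrix; $\mathcal{CB}$ denotes the space of maps with $\|T\|_{cb}<\infty$. The dual operator space $V^*$ of an operator space $V$ has $M_n(V^*):=\mathcal{CB}(V,M_n)$, where $[f_{ij}]$ is identified with $x\mapsto[f_{ij}(x)]$ and $M_m(M_n)=M_{mn}$. An operator space $V$ is homogeneous if $\mathcal{CB}(V)=\mathcal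 B(M_1(V))$ holds isometrically. For a Banach space $E$ and $n\in\mathbb N$, let $\min(E)^{[n]}$ be $E^n$ with the norm of $\mathcal B(\ell^2_n,E)$, where $x=(x_j)$ is identified with $\xi\mapsto\sum_j\xi_jx_j$, and let $\max(E)^{[n]}$ be $E^n$ with the norm $$\|x\|:=\inf\{\|\alpha\|\,\|y\|_{\ell^2_m(E)} : m\in\mathbb N,\ \alpha\in M_{n,m},\ y\in E^m,\ x=\alpha y\}.$$ For $X=\min(E)$ or $X=\max(E)$, define $\operatorname{Min}(X)$ by $M_n(\operatorname{Min}(X)):=\mathcal B(\ell^2_n,X^{[n]})$, where $x=[x_{ij}]$ is identified with $\xi\mapsto\left(\sum_jx_{ij}\xi_j\right)_i$, and define $\operatorname{Max}(X)$ by $$\|x\|_{M_n(\operatorname{Max}(X))}:=\inf\{\|\alpha\|\,\|\beta\| : x=\alpha\operatorname{diag}(v_1,\dots,v_k)\beta\},$$ where the infimum is taken over all $k,l\in\mathbb N$, $\alpha\in M_{n,kl}$, $\beta\in M_{k,n}$ and $v_1,\dots,v_k$ in the closed unit ball of $X^{[l]}$, and where $\operatorname{diag}(v_1,\dots,v_k)$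 is the $kl\times k$ matrix with the columns $v_1,\dots,v_k$ as its diagonal blocks. Put $$\operatorname{COL}(E):=\operatorname{Min}(\max(E)),\qquad \operatorname{ROW}(E):=\operatorname{Max}(\min(E)).$$ Theorem. Let $E$ be a Banach space. Then $\operatorname{COL}(E)$ and $\operatorname{ROW}(E)$ are homogeneous operator spaces over $E$, and the identity map of $E^*$ gives completely isometric identifications $$\operatorname{COL}(E)^*=\operatorname{ROW}(E^*)\qquad\text{and}\qquad\operatorname{ROW}(E)^*=\operatorname{COL}(E^*).$$ -/

import Mathlib

open scoped ENNReal Matrix.Norms.L2Operator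

noncomputable section

namespace OpSpace

/-! Scalar matrices carry the operator norm between Euclidean spaces (the scoped norm
`Matrix.Norms.L2Operator`). Matrix sizes range over all of `ℕ`; size `0` contributes only the
zero space. -/

/-- A sequence of (candidate) norms on the spaces `E ^ n` of columns with `n` entries. -/
abbrev SeqNorms (E : Type*) := ∀ n : ℕ, (Fin n → E) → ℝ

/-- A sequence of (candidate) norms on the spaces `M_n(V)` of square matrices over `V`. -/
abbrev MatNorms (V : Type*) := ∀ n : ℕ, Matrix (Fin n) (Fin n) V → ℝ

section Products

variable {V : Type*} [AddCommGroup V] [Module ℂ V]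
variable {ι κ μ : Type*} [Fintype κ]

/-- The product `α x` of a scalar matrix `α` with a matrix `x` over a vector space. -/
def lmul (α : Matrix ι κ ℂ) (x : Matrix κ μ V) : Matrix ι μ V :=
  Matrix.of fun i j => ∑ k, α i k • x k j

/-- The product `x β` of a matrix `x` over a vector space with a scalar matrix `β`. -/
def rmul (x : Matrix ι κ V) (β : Matrix κ μ ℂ) : Matrix ι μ V :=
  Matrix.of fun i j => ∑ k, β k j • x i k

/-- The column `α y`, for a scalar matrix `α` and a column `y` over a vector space. -/
def colMul (α : Matrix ι κ ℂ) (y : κ → V) : ι → V :=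
  fun i => ∑ k, α i k • y k

/-- The column `x ξ`, for a matrix `x` over a vector space and a vector of scalars `ξ`. -/
def applyVec (x : Matrix ι κ V) (ξ : EuclideanSpace ℂ κ) : ι → V :=
  fun i => ∑ k, ξ k • x i k

/-- The matrix `diag(v_1, …, v_k)` of size `kl × k` with the columns `v_1, …, v_k` (each with `l`
entries) down the block diagonal and zeros elsewhere. -/
def blockDiag {k l : ℕ} (v : Fin k → Fin l → V) : Matrix (Fin k × Fin l) (Fin k) V :=
  Matrix.of fun p j => if p.1 = j then v p.1 p.2 else 0

/-- The direct sum `x ⊕ y` of two square matrices over a vector space. -/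
def dirSum {m n : ℕ} (x : Matrix (Fin m) (Fin m) V) (y : Matrix (Fin n) (Fin n) V) :
    Matrix (Fin (m + n)) (Fin (m + n)) V :=
  Matrix.reindex finSumFinEquiv finSumFinEquiv (Matrix.fromBlocks x 0 0 y)

end Products

/-- The `[0, ∞]`-valued norm of a map `T : X → Y`, with respect to `p` on `X` and `q` on `Y`: the
supremum of `q (T x)` over the unit ball of `p`. -/
def mapNorm {X Y : Type*} (p : X → ℝ) (q : Y → ℝ) (T : X → Y) : ℝ≥0∞ :=
  ⨆ (x : X) (_ : p x ≤ 1), ENNReal.ofReal (q (T x))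

section CompletelyBounded

variable {V W : Type*} [AddCommGroup V] [Module ℂ V] [AddCommGroup W] [Module ℂ W]

/-- The completely bounded norm `sup_n ‖T_n : M_n(V) → M_n(W)‖`, with values in `[0, ∞]`; here
`T_n` is the amplification of `T` obtained by applying `T` to each entry. -/
def cbNorm (M : MatNorms V) (N : MatNorms W) (T : V →ₗ[ℂ] W) : ℝ≥0∞ :=
  ⨆ n : ℕ, mapNorm (M n) (N n) (fun x => x.map T)

/-- `T` is completely bounded, i.e. belongs to `CB(V, W)`. -/
def IsCompletelyBounded (M : MatNorms V) (N : MatNorms W) (T : V →ₗ[ℂ] W) : Prop :=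
  cbNorm M N T < ∞

end CompletelyBounded

/-- The operator space structure on `M_n(ℂ)`, given by the identification
`M_m(M_n(ℂ)) = M_{mn}(ℂ)`. -/
def scalarMat (n : ℕ) : MatNorms (Matrix (Fin n) (Fin n) ℂ) :=
  fun m x => ‖Matrix.comp (Fin m) (Fin m) (Fin n) (Fin n) ℂ x‖

section Normed

variable {E : Type*} [NormedAddCommGroup E] [NormedSpace ℂ E]

/-- `M` turns the normed space `E` into an (abstract) operator space: each `M n` is a norm on
`M_n(E)`, the norm `M 1` is the given norm of `E`, and Ruan's two axioms hold. -/
structure IsOperatorSpace (M : MatNorms E) : Prop where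
  triangle : ∀ (n : ℕ) (x y : Matrix (Fin n) (Fin n) E), M n (x + y) ≤ M n x + M n y
  homog : ∀ (n : ℕ) (c : ℂ) (x : Matrix (Fin n) (Fin n) E), M n (c • x) = ‖c‖ * M n x
  definite : ∀ (n : ℕ) (x : Matrix (Fin n) (Fin n) E), M n x = 0 → x = 0
  norm_one : ∀ x : Matrix (Fin 1) (Fin 1) E, M 1 x = ‖x 0 0‖
  norm_dirSum : ∀ (m n : ℕ) (x : Matrix (Fin m) (Fin m) E) (y : Matrix (Fin n) (Fin n) E),
    M (m + n) (dirSum x y) = max (M m x) (M n y)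
  norm_mul : ∀ (m n : ℕ) (α : Matrix (Fin n) (Fin m) ℂ) (x : Matrix (Fin m) (Fin m) E)
    (β : Matrix (Fin m) (Fin n) ℂ), M n (rmul (lmul α x) β) ≤ ‖α‖ * M m x * ‖β‖

/-- For an operator space structure `M` on `E`: `CB(E) = B(M_1(E))` holds isometrically. -/
def IsHomogeneous (M : MatNorms E) : Prop :=
  (∀ T : E →ₗ[ℂ] E, IsCompletelyBounded M M T ↔ Continuous T) ∧
    ∀ T : E →L[ℂ] E, cbNorm M M (T : E →ₗ[ℂ] E) = ‖T‖ₑ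

/-- The map `E → M_n(ℂ)`, `x ↦ [f_{ij}(x)]`, given by a matrix `f` of bounded functionals. -/
def functionalMatrix {n : ℕ} (f : Matrix (Fin n) (Fin n) (StrongDual ℂ E)) :
    E →ₗ[ℂ] Matrix (Fin n) (Fin n) ℂ where
  toFun x := Matrix.of fun i j => f i j x
  map_add' x y := by ext i j; simp
  map_smul' c x := by ext i j; simp

/-- The dual operator space: a matrix norm on the Banach space dual of `E`, through
`M_n(E^*) = CB(E, M_n(ℂ))`. -/
def dual (M : MatNorms E) : MatNorms (StrongDual ℂ E) :=
  fun n f => (cbNorm M (scalarMat n) (functionalMatrix f)).toReal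

/-- The operator `ℓ²_n → E`, `ξ ↦ ∑ ξ_j x_j`, that corresponds to a column `x`. -/
def columnOperator {n : ℕ} (x : Fin n → E) : EuclideanSpace ℂ (Fin n) →L[ℂ] E :=
  ∑ j, (EuclideanSpace.proj j : EuclideanSpace ℂ (Fin n) →L[ℂ] ℂ).smulRight (x j)

variable (E) in
/-- The minimal operator sequence space `min(E)`: the `n`-th norm is that of `B(ℓ²_n, E)`. -/
def minSeq : SeqNorms E :=
  fun _ x => ‖columnOperator x‖

variable (E) in
/-- The maximal operator sequence space `max(E)`: the `n`-th norm of `x` is the infimum of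
`‖α‖ ‖y‖` over all factorizations `x = α y` with `α ∈ M_{n,m}(ℂ)` and `y ∈ ℓ²_m(E)`. -/
def maxSeq : SeqNorms E :=
  fun n x => sInf {r : ℝ | ∃ (m : ℕ) (α : Matrix (Fin n) (Fin m) ℂ)
    (y : PiLp 2 (fun _ : Fin m => E)), x = colMul α y.ofLp ∧ r = ‖α‖ * ‖y‖}

/-- The minimal operator space over an operator sequence space `X`:
`M_n(Min(X)) = B(ℓ²_n, X^n)`, where `X^n` carries the `n`-th norm and the matrix `x` acts by
`ξ ↦ x ξ`. -/
def MinOp (X : SeqNorms E) : MatNorms E :=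
  fun n x => (mapNorm (fun ξ : EuclideanSpace ℂ (Fin n) => ‖ξ‖) (X n) (applyVec x)).toReal

/-- The maximal operator space over an operator sequence space `X`: the norm of `x ∈ M_n(E)` is the
infimum of `‖α‖ ‖β‖` over all factorizations `x = α diag(v_1, …, v_k) β` with `α ∈ M_{n,kl}(ℂ)`,
`β ∈ M_{k,n}(ℂ)` and `v_1, …, v_k` in the closed unit ball of the `l`-th norm of `X`. -/
def MaxOp (X : SeqNorms E) : MatNorms E :=
  fun n x => sInf {r : ℝ | ∃ (k l : ℕ) (α : Matrix (Fin n) (Fin k × Fin l) ℂ)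
    (v : Fin k → Fin l → E) (β : Matrix (Fin k) (Fin n) ℂ),
    (∀ i, X l (v i) ≤ 1) ∧ x = rmul (lmul α (blockDiag v)) β ∧ r = ‖α‖ * ‖β‖}

variable (E) in
/-- The column operator space `COL(E) = Min(max(E))`. -/
def COL : MatNorms E := MinOp (maxSeq E)

variable (E) in
/-- The row operator space `ROW(E) = Max(min(E))`. -/
def ROW : MatNorms E := MaxOp (minSeq E)

end Normed

end OpSpace

end

namespace OpSpace

/-! A matrix in M_n(COL(E)) is an operator from ℓ²_n to max(E)^[n]; a matrix in M_n(ROW(F)) is a sum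
of terms α v β with columns v in the unit ball of min(F). The two meet because max and min are dual
for the ℓ² norm: if x = α y with a contraction α, the scalars B(x_i, v_p) have ℓ² norm at most ‖y‖
‖v‖_min (`sqNorm_pairing_le`). Inserting a row factorization and applying Cauchy–Schwarz over its
blocks shows that a contractive bilinear form on E × F is jointly completely contractive on COL(E) ×
ROW(F) (`norm_pairing_le`). This gives one inequality in each duality. The operator space axioms and
homogeneity hold because factorizations can be concatenated, multiplied by scalar matrices and
mapped by operators.

The reverse inequalities rest on three descriptions of functionals. A functional on max(F)^[n] is a
2-summing column over F^*, hence by Pietsch a Hilbert–Schmidt matrix times a column in the unit ball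
of min(F^*) (`exists_factorization_of_le_maxSeq`). A functional on B(ℓ²_n, Y) is, up to ε, an ℓ¹ sum
of functionals v ↦ φ(v ξ), because evaluation on a finite net embeds this space in a finite ℓ^∞ sum
of copies of Y (`exists_nuclear_representation`). A contractive functional on M_n(ROW(F)) is
dominated by a density on either side (`exists_two_sided_domination`).

To bound the ROW(E^*) norm of f by its norm K as a functional matrix on COL(E), take a functional Φ
that norms f, with densities given by r and s. Then r f sᵀ is a functional on M_n(COL(E)) of norm at
most about K. The nuclear representation and the Pietsch factorization split it into terms (c_k v_k)
ξ_kᵀ of total weight about K. Undoing r and s splits f itself, and Φ is at most about the weight on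
each term. For COL(E^*) the same scheme runs on a single column; there the norming functional
involves elements of the bidual, but they are applied only to an identity between elements of E^*,
so local reflexivity is not needed. -/

/-- The square of the `ℓ²` norm of a finite family. -/
noncomputable def sqNorm {ι V : Type*} [Fintype ι] [Norm V] (x : ι → V) : ℝ := ∑ i, ‖x i‖ ^ 2

/-! ### Operator norms of scalar matrices through ℓ² inequalities -/

section ScalarMatrices

variable {ι κ : Type*} [Fintype ι] [Fintype κ]

lemma sqNorm_nonneg {V : Type*} [Norm V] (x : ι → V) : 0 ≤ sqNorm x :=
  Finset.sum_nonneg fun _ _ => sq_nonneg _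

lemma sqNorm_smul {V : Type*} [SeminormedAddCommGroup V] [NormedSpace ℂ V] (c : ℂ) (x : ι → V) :
    sqNorm (c • x) = ‖c‖ ^ 2 * sqNorm x := by
  simp [sqNorm, norm_smul, mul_pow, Finset.mul_sum]

lemma sqNorm_eq_norm_sq {V : Type*} [SeminormedAddCommGroup V] (x : PiLp 2 (fun _ : ι => V)) :
    sqNorm x.ofLp = ‖x‖ ^ 2 := by
  rw [PiLp.norm_sq_eq_of_L2]; rfl

lemma sqrt_sqNorm {V : Type*} [SeminormedAddCommGroup V] (x : ι → V) :
    √(sqNorm x) = ‖(WithLp.toLp 2 x : PiLp 2 (fun _ : ι => V))‖ := by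
  rw [← Real.sqrt_sq (norm_nonneg (WithLp.toLp 2 x)), ← sqNorm_eq_norm_sq]

lemma sq_norm_sum_mul_le (a b : ι → ℂ) : ‖∑ i, a i * b i‖ ^ 2 ≤ sqNorm a * sqNorm b := by
  calc ‖∑ i, a i * b i‖ ^ 2 ≤ (∑ i, ‖a i‖ * ‖b i‖) ^ 2 := by
        gcongr
        exact (norm_sum_le _ _).trans_eq (by simp)
    _ ≤ _ := Finset.sum_mul_sq_le_sq_mul_sq _ _ _

lemma norm_sum_mul_le (a b : ι → ℂ) : ‖∑ i, a i * b i‖ ≤ √(sqNorm a) * √(sqNorm b) := by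
  rw [← Real.sqrt_mul (sqNorm_nonneg _)]
  exact Real.le_sqrt_of_sq_le (sq_norm_sum_mul_le a b)

/-- The norm of a finite family of scalars is attained by pairing it with a suitable family. -/
lemma sqNorm_le_of_pairing {a : ι → ℂ} {C : ℝ} (hC : 0 ≤ C)
    (h : ∀ b : ι → ℂ, ‖∑ i, b i * a i‖ ≤ C * √(sqNorm b)) : sqNorm a ≤ C ^ 2 := by
  -- With the conjugate family the pairing becomes ‖a‖², so that ‖a‖² ≤ C ‖a‖.
  have h1 := h (fun i => star (a i))
  have h2 : ∑ i, star (a i) * a i = ((sqNorm a : ℝ) : ℂ) := by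
    simp [sqNorm, Complex.conj_mul']
  have h3 : sqNorm (fun i => star (a i)) = sqNorm a := by simp [sqNorm]
  rw [h2, h3, Complex.norm_real, Real.norm_of_nonneg (sqNorm_nonneg _)] at h1
  have h4 := Real.mul_self_sqrt (sqNorm_nonneg a)
  have h5 := Real.sqrt_nonneg (sqNorm a)
  rcases h5.eq_or_lt with h6 | h6
  · rw [← h6] at h4
    nlinarith
  · have : √(sqNorm a) ≤ C := le_of_mul_le_mul_right (h4.trans_le h1) h6
    nlinarith

section
variable [DecidableEq κ]

lemma sqNorm_mulVec_le (α : Matrix ι κ ℂ) (ξ : κ → ℂ) :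
    sqNorm (fun i => ∑ k, α i k * ξ k) ≤ ‖α‖ ^ 2 * sqNorm ξ := by
  have h := Matrix.l2_opNorm_mulVec α (WithLp.toLp 2 ξ)
  have h2 := pow_le_pow_left₀ (norm_nonneg _) h 2
  rw [mul_pow, ← sqNorm_eq_norm_sq, ← sqNorm_eq_norm_sq] at h2
  exact h2

lemma norm_le_of_mulVec {α : Matrix ι κ ℂ} {C : ℝ} (hC : 0 ≤ C)
    (h : ∀ ξ : κ → ℂ, sqNorm (fun i => ∑ k, α i k * ξ k) ≤ C ^ 2 * sqNorm ξ) : ‖α‖ ≤ C := by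
  rw [Matrix.l2_opNorm_def]
  refine ContinuousLinearMap.opNorm_le_bound _ hC fun ξ => ?_
  refine (pow_le_pow_iff_left₀ (norm_nonneg _) (by positivity) two_ne_zero).1 ?_
  rw [mul_pow, ← sqNorm_eq_norm_sq, ← sqNorm_eq_norm_sq]
  exact h ξ.ofLp

lemma norm_bilin_le (α : Matrix ι κ ℂ) (ξ : ι → ℂ) (η : κ → ℂ) :
    ‖∑ i, ∑ k, ξ i * α i k * η k‖ ≤ ‖α‖ * √(sqNorm ξ) * √(sqNorm η) := by
  have h := norm_sum_mul_le ξ (fun i => ∑ k, α i k * η k)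
  have h2 := Real.sqrt_le_sqrt (sqNorm_mulVec_le α η)
  rw [Real.sqrt_mul (by positivity), Real.sqrt_sq (norm_nonneg _)] at h2
  simp only [mul_assoc, ← Finset.mul_sum]
  calc _ ≤ _ := h
    _ ≤ √(sqNorm ξ) * (‖α‖ * √(sqNorm η)) := by gcongr
    _ = _ := by ring

lemma norm_le_of_bilin {α : Matrix ι κ ℂ} {C : ℝ} (hC : 0 ≤ C)
    (h : ∀ (ξ : ι → ℂ) (η : κ → ℂ),
      ‖∑ i, ∑ k, ξ i * α i k * η k‖ ≤ C * √(sqNorm ξ) * √(sqNorm η)) : ‖α‖ ≤ C := by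
  refine norm_le_of_mulVec hC fun η => ?_
  rw [← Real.sq_sqrt (sqNorm_nonneg η), ← mul_pow]
  refine sqNorm_le_of_pairing (by positivity) fun ξ => ?_
  have := h ξ η
  simp only [mul_assoc, ← Finset.mul_sum] at this
  exact this.trans_eq (by ring)

lemma sqNorm_vecMul_le (α : Matrix ι κ ℂ) (ξ : ι → ℂ) :
    sqNorm (fun k => ∑ i, ξ i * α i k) ≤ ‖α‖ ^ 2 * sqNorm ξ := by
  rw [← Real.sq_sqrt (sqNorm_nonneg ξ), ← mul_pow]
  refine sqNorm_le_of_pairing (by positivity) fun η => ?_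
  have := norm_bilin_le α ξ η
  rw [Finset.sum_comm] at this
  simp only [← Finset.sum_mul] at this
  simpa only [mul_comm (η _)] using this

lemma norm_le_of_vecMul {α : Matrix ι κ ℂ} {C : ℝ} (hC : 0 ≤ C)
    (h : ∀ ξ : ι → ℂ, sqNorm (fun k => ∑ i, ξ i * α i k) ≤ C ^ 2 * sqNorm ξ) : ‖α‖ ≤ C := by
  refine norm_le_of_bilin hC fun ξ η => ?_
  rw [Finset.sum_comm]
  simp only [← Finset.sum_mul]
  refine (norm_sum_mul_le _ _).trans ?_
  gcongr
  rw [← Real.sqrt_sq hC, ← Real.sqrt_mul (by positivity)]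
  exact Real.sqrt_le_sqrt (h ξ)

lemma norm_one_le_one : ‖(1 : Matrix κ κ ℂ)‖ ≤ 1 := by
  refine norm_le_of_mulVec zero_le_one fun ξ => ?_
  simp [Matrix.one_apply]

end

end ScalarMatrices

/-! ### The minimal and maximal operator sequence spaces -/

section General

variable {E : Type*} [NormedAddCommGroup E] [NormedSpace ℂ E]

lemma columnOperator_apply {n : ℕ} (x : Fin n → E) (ξ : EuclideanSpace ℂ (Fin n)) :
    columnOperator x ξ = ∑ j, ξ j • x j := by
  simp [columnOperator]

lemma minSeq_nonneg {n : ℕ} (x : Fin n → E) : 0 ≤ minSeq E n x := norm_nonneg _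

lemma norm_sum_smul_le_minSeq {n : ℕ} (x : Fin n → E) (ξ : Fin n → ℂ) :
    ‖∑ j, ξ j • x j‖ ≤ minSeq E n x * √(sqNorm ξ) := by
  have := (columnOperator x).le_opNorm (WithLp.toLp 2 ξ)
  rwa [columnOperator_apply, ← sqrt_sqNorm] at this

lemma minSeq_le {n : ℕ} {x : Fin n → E} {C : ℝ} (hC : 0 ≤ C)
    (h : ∀ ξ : Fin n → ℂ, ‖∑ j, ξ j • x j‖ ≤ C * √(sqNorm ξ)) : minSeq E n x ≤ C := by
  refine ContinuousLinearMap.opNorm_le_bound _ hC fun ξ => ?_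
  have := h ξ.ofLp
  rwa [sqrt_sqNorm, ← columnOperator_apply x] at this

lemma sqNorm_functional_le {n : ℕ} (x : Fin n → E) (φ : StrongDual ℂ E) :
    sqNorm (fun j => φ (x j)) ≤ (‖φ‖ * minSeq E n x) ^ 2 := by
  refine sqNorm_le_of_pairing (mul_nonneg (norm_nonneg _) (minSeq_nonneg _)) fun ξ => ?_
  have h1 : ∑ j, ξ j * φ (x j) = φ (∑ j, ξ j • x j) := by simp
  rw [h1]
  calc _ ≤ ‖φ‖ * ‖∑ j, ξ j • x j‖ := φ.le_opNorm _
    _ ≤ ‖φ‖ * (minSeq E n x * √(sqNorm ξ)) := by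
      gcongr; exact norm_sum_smul_le_minSeq x ξ
    _ = _ := by ring

/-! ### The maximal operator sequence space -/

lemma maxSeq_nonneg {n : ℕ} (x : Fin n → E) : 0 ≤ maxSeq E n x := by
  refine Real.sInf_nonneg ?_
  rintro _ ⟨m, α, y, -, rfl⟩
  positivity

/-- Arbitrary finite index types allow factorizations to be concatenated over sum types without
renumbering. -/
lemma maxSeq_le {κ : Type*} [Fintype κ] [DecidableEq κ] {n : ℕ} {x : Fin n → E}
    (α : Matrix (Fin n) κ ℂ) (y : κ → E) {a b : ℝ} (hx : ∀ i, x i = ∑ k, α i k • y k)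
    (hα : ‖α‖ ≤ a) (hb : 0 ≤ b) (hy : sqNorm y ≤ b ^ 2) : maxSeq E n x ≤ a * b := by
  let e := Fintype.equivFin κ
  have ha : 0 ≤ a := (norm_nonneg _).trans hα
  have h1 : ‖α.submatrix id e.symm‖ ≤ a := by
    refine norm_le_of_vecMul ha fun ξ => ?_
    calc _ = sqNorm (fun k => ∑ i, ξ i * α i k) :=
          e.symm.sum_comp (fun k => ‖∑ i, ξ i * α i k‖ ^ 2)
      _ ≤ ‖α‖ ^ 2 * sqNorm ξ := sqNorm_vecMul_le _ _
      _ ≤ _ := by gcongr; exact sqNorm_nonneg _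
  have h2 : ‖(WithLp.toLp 2 (y ∘ e.symm) : PiLp 2 (fun _ : Fin (Fintype.card κ) => E))‖ ≤ b := by
    rw [← sqrt_sqNorm]
    refine Real.sqrt_le_iff.2 ⟨hb, le_trans (le_of_eq ?_) hy⟩
    exact e.symm.sum_comp (fun k => ‖y k‖ ^ 2)
  unfold maxSeq
  refine (csInf_le (a := ‖α.submatrix id e.symm‖ * ‖(WithLp.toLp 2 (y ∘ e.symm) :
    PiLp 2 (fun _ : Fin (Fintype.card κ) => E))‖) ⟨0, ?_⟩ ?_).trans ?_
  · rintro _ ⟨m, α, y, -, rfl⟩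
    positivity
  · refine ⟨_, α.submatrix id e.symm, WithLp.toLp 2 (y ∘ e.symm), ?_, rfl⟩
    ext i
    rw [hx i]
    exact (e.symm.sum_comp (fun k => α i k • y k)).symm
  · gcongr

/-- A near-optimal factorization is rescaled so that `α` is a contraction and `y` carries the whole
norm. For `α = 0` the empty factorization serves. -/
lemma exists_of_maxSeq_lt {n : ℕ} {x : Fin n → E} {t : ℝ} (h : maxSeq E n x < t) :
    ∃ (m : ℕ) (α : Matrix (Fin n) (Fin m) ℂ) (y : Fin m → E),
      (∀ i, x i = ∑ k, α i k • y k) ∧ ‖α‖ ≤ 1 ∧ sqNorm y ≤ t ^ 2 := by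
  unfold maxSeq at h
  obtain ⟨_, ⟨m, α, y, hx, rfl⟩, hr⟩ := exists_lt_of_csInf_lt
    (by exact ⟨_, n, 1, WithLp.toLp 2 x, by ext i; simp [colMul, Matrix.one_apply], rfl⟩) h
  rcases eq_or_ne α 0 with h0 | h0
  · refine ⟨0, 0, 0, fun i => ?_, by simp, by simp [sqNorm]; positivity⟩
    simp [hx, h0, colMul]
  · have hα : 0 < ‖α‖ := norm_pos_iff.2 h0
    refine ⟨m, (‖α‖⁻¹ : ℂ) • α, (‖α‖ : ℂ) • y.ofLp, fun i => ?_, ?_, ?_⟩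
    · rw [hx]
      refine Finset.sum_congr rfl fun k _ => ?_
      have : (‖α‖ : ℂ) ≠ 0 := by exact_mod_cast hα.ne'
      simp only [Matrix.smul_apply, Pi.smul_apply, smul_smul, smul_eq_mul]
      congr 1
      field_simp
    · rw [norm_smul]
      simp [hα.ne']
    · rw [sqNorm_smul, sqNorm_eq_norm_sq, ← mul_pow]
      simp only [Complex.norm_real, norm_norm]
      gcongr

lemma maxSeq_add {n : ℕ} (x y : Fin n → E) :
    maxSeq E n (x + y) ≤ maxSeq E n x + maxSeq E n y := by
  refine le_of_forall_pos_le_add fun ε hε => ?_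
  set s := maxSeq E n x + ε / 2 with hs
  set t := maxSeq E n y + ε / 2 with ht
  have hs0 : 0 < s := by have := maxSeq_nonneg x; linarith
  have ht0 : 0 < t := by have := maxSeq_nonneg y; linarith
  obtain ⟨m, α, u, hx, hα, hu⟩ := exists_of_maxSeq_lt (show maxSeq E n x < s by linarith)
  obtain ⟨m', β, v, hy, hβ, hv⟩ := exists_of_maxSeq_lt (show maxSeq E n y < t by linarith)
  have hs1 : ((√s : ℝ) : ℂ) ≠ 0 := by exact_mod_cast (Real.sqrt_pos.2 hs0).ne'
  have ht1 : ((√t : ℝ) : ℂ) ≠ 0 := by exact_mod_cast (Real.sqrt_pos.2 ht0).ne'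
  have key : maxSeq E n (x + y) ≤ √(s + t) * √(s + t) := by
    -- The factorizations stand side by side, with weights `√s`, `√t` on the left and their inverses
    -- on the right; both factors then have squared norm at most `s + t`.
    refine maxSeq_le (κ := Fin m ⊕ Fin m')
      (Matrix.of fun i => Sum.elim (fun k => (√s : ℂ) * α i k) (fun k => (√t : ℂ) * β i k))
      (Sum.elim (fun k => (√s : ℂ)⁻¹ • u k) (fun k => (√t : ℂ)⁻¹ • v k)) (fun i => ?_) ?_
      (by positivity) ?_
    · simp only [Pi.add_apply, hx, hy, Matrix.of_apply, Fintype.sum_sum_type, Sum.elim_inl,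
        Sum.elim_inr, smul_smul]
      congr 1 <;> refine Finset.sum_congr rfl fun k _ => ?_ <;> congr 1 <;> field_simp
    · refine norm_le_of_vecMul (by positivity) fun ξ => ?_
      have h1 := sqNorm_vecMul_le α ξ
      have h2 := sqNorm_vecMul_le β ξ
      have h3 : ‖α‖ ^ 2 ≤ 1 := pow_le_one₀ (norm_nonneg _) hα
      have h4 : ‖β‖ ^ 2 ≤ 1 := pow_le_one₀ (norm_nonneg _) hβ
      rw [Real.sq_sqrt (by positivity), add_mul]
      have h5 := sqNorm_nonneg ξ
      have e1 : ∀ k, ∑ i, ξ i * ((√s : ℂ) * α i k) = √s * ∑ i, ξ i * α i k := fun k => by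
        rw [Finset.mul_sum]; exact Finset.sum_congr rfl fun i _ => by ring
      have e2 : ∀ k, ∑ i, ξ i * ((√t : ℂ) * β i k) = √t * ∑ i, ξ i * β i k := fun k => by
        rw [Finset.mul_sum]; exact Finset.sum_congr rfl fun i _ => by ring
      simp only [sqNorm, Fintype.sum_sum_type, Matrix.of_apply, Sum.elim_inl, Sum.elim_inr, e1, e2,
        norm_mul, mul_pow, ← Finset.mul_sum, Complex.norm_real, Real.norm_eq_abs, sq_abs,
        Real.sq_sqrt hs0.le, Real.sq_sqrt ht0.le]
      simp only [sqNorm] at h1 h2 h5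
      gcongr <;> nlinarith
    · rw [Real.sq_sqrt (by positivity)]
      simp only [sqNorm, Fintype.sum_sum_type, Sum.elim_inl, Sum.elim_inr, norm_smul, mul_pow,
        ← Finset.mul_sum, norm_inv, Complex.norm_real, Real.norm_eq_abs, inv_pow, sq_abs,
        Real.sq_sqrt hs0.le, Real.sq_sqrt ht0.le]
      simp only [sqNorm] at hu hv
      gcongr
      · rw [inv_mul_le_iff₀ hs0]; linarith
      · rw [inv_mul_le_iff₀ ht0]; linarith
  rw [Real.mul_self_sqrt (by positivity)] at key
  linarith

lemma maxSeq_colMul_le {n m : ℕ} (α : Matrix (Fin n) (Fin m) ℂ) (x : Fin m → E) :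
    maxSeq E n (colMul α x) ≤ ‖α‖ * maxSeq E m x := by
  refine le_of_forall_gt_imp_ge_of_dense fun c hc => ?_
  have : ∃ t, maxSeq E m x < t ∧ ‖α‖ * t ≤ c := by
    rcases (norm_nonneg α).eq_or_lt with h | h
    · exact ⟨maxSeq E m x + 1, by linarith, by rw [← h] at hc ⊢; linarith⟩
    · refine ⟨c / ‖α‖, by rwa [lt_div_iff₀' h], by field_simp; rfl⟩
  obtain ⟨t, ht, htc⟩ := this
  obtain ⟨k, β, y, hx, hβ, hy⟩ := exists_of_maxSeq_lt ht
  refine (maxSeq_le (α * β) y (fun i => ?_) ((Matrix.l2_opNorm_mul _ _).trans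
    (mul_le_of_le_one_right (norm_nonneg _) hβ)) ((maxSeq_nonneg _).trans ht.le) hy).trans htc
  simp only [colMul, hx, Finset.smul_sum, smul_smul, Matrix.mul_apply, Finset.sum_smul]
  exact Finset.sum_comm

lemma maxSeq_zero {n : ℕ} : maxSeq E n 0 = 0 := by
  refine le_antisymm ?_ (maxSeq_nonneg _)
  have := maxSeq_colMul_le (0 : Matrix (Fin n) (Fin n) ℂ) (0 : Fin n → E)
  have h2 : colMul (0 : Matrix (Fin n) (Fin n) ℂ) (0 : Fin n → E) = 0 := by ext; simp [colMul]
  rw [h2] at this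
  simpa using this

lemma maxSeq_smul_le {n : ℕ} (c : ℂ) (x : Fin n → E) :
    maxSeq E n (c • x) ≤ ‖c‖ * maxSeq E n x := by
  have h : c • x = colMul (c • (1 : Matrix (Fin n) (Fin n) ℂ)) x := by
    ext i; simp [colMul, Matrix.one_apply]
  rw [h]
  refine (maxSeq_colMul_le _ _).trans ?_
  have := maxSeq_nonneg x
  gcongr
  rw [norm_smul]
  exact mul_le_of_le_one_right (norm_nonneg _) norm_one_le_one

/-- The norm of `max(E)^[n]` as a seminorm. -/
noncomputable def maxSeminorm (E : Type*) [NormedAddCommGroup E] [NormedSpace ℂ E] (n : ℕ) :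
    Seminorm ℂ (Fin n → E) :=
  Seminorm.ofSMulLE (maxSeq E n) maxSeq_zero maxSeq_add maxSeq_smul_le

@[simp] lemma maxSeminorm_apply {n : ℕ} (x : Fin n → E) : maxSeminorm E n x = maxSeq E n x := rfl

lemma maxSeq_le_sqrt {n : ℕ} (x : Fin n → E) : maxSeq E n x ≤ √(sqNorm x) := by
  have := maxSeq_le (1 : Matrix (Fin n) (Fin n) ℂ) x (x := x) (by simp [Matrix.one_apply])
    norm_one_le_one (Real.sqrt_nonneg _) (Real.sq_sqrt (sqNorm_nonneg x)).ge
  simpa using this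

lemma maxSeq_map_le {F : Type*} [NormedAddCommGroup F] [NormedSpace ℂ F] (T : E →L[ℂ] F) {n : ℕ}
    (x : Fin n → E) : maxSeq F n (fun i => T (x i)) ≤ ‖T‖ * maxSeq E n x := by
  refine le_of_forall_pos_le_add fun ε hε => ?_
  have hd : 0 < ε / (‖T‖ + 1) := by positivity
  obtain ⟨k, β, y, hx, hβ, hy⟩ :=
    exists_of_maxSeq_lt (show maxSeq E n x < maxSeq E n x + ε / (‖T‖ + 1) by linarith)
  have h0 := maxSeq_nonneg x
  refine (maxSeq_le (b := ‖T‖ * (maxSeq E n x + ε / (‖T‖ + 1))) β (fun k => T (y k))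
    (fun i => by simp [hx]) hβ (by positivity) ?_).trans ?_
  · calc sqNorm (fun k => T (y k)) ≤ ∑ k, (‖T‖ * ‖y k‖) ^ 2 := by
          unfold sqNorm; gcongr; exact T.le_opNorm _
      _ = ‖T‖ ^ 2 * sqNorm y := by simp [sqNorm, mul_pow, Finset.mul_sum]
      _ ≤ _ := by rw [mul_pow]; gcongr
  · have : ‖T‖ * (ε / (‖T‖ + 1)) ≤ ε := by
      rw [mul_div_assoc', div_le_iff₀ (by positivity)]; nlinarith
    linarith

/-- The pairing of a column over `max(E)` with a column over `min(F)`. -/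
lemma sqNorm_pairing_le {F : Type*} [NormedAddCommGroup F] [NormedSpace ℂ F]
    (B : E →L[ℂ] F →L[ℂ] ℂ) (hB : ‖B‖ ≤ 1) {n l : ℕ} (x : Fin n → E) (v : Fin l → F) :
    sqNorm (fun q : Fin n × Fin l => B (x q.1) (v q.2)) ≤ (maxSeq E n x * minSeq F l v) ^ 2 := by
  have h0 := minSeq_nonneg v
  have key : ∀ t, maxSeq E n x < t →
      sqNorm (fun q : Fin n × Fin l => B (x q.1) (v q.2)) ≤ (t * minSeq F l v) ^ 2 := by
    intro t ht
    obtain ⟨m, α, y, hx, hα, hy⟩ := exists_of_maxSeq_lt ht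
    calc sqNorm (fun q : Fin n × Fin l => B (x q.1) (v q.2))
        = ∑ p, sqNorm (fun i => ∑ k, α i k * B (y k) (v p)) := by
          simp only [sqNorm, Fintype.sum_prod_type_right, hx]
          simp
      -- For each `p` the contraction `α` acts on ℓ² and can be dropped. After the sums are
      -- exchanged, each functional `B (y k)` meets the whole column `v`.
      _ ≤ ∑ p, sqNorm (fun k => B (y k) (v p)) := by
          gcongr with p
          refine (sqNorm_mulVec_le α _).trans (mul_le_of_le_one_left (sqNorm_nonneg _) ?_)
          exact pow_le_one₀ (norm_nonneg _) hα
      _ = ∑ k, sqNorm (fun p => B (y k) (v p)) := Finset.sum_comm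
      _ ≤ ∑ k, (‖y k‖ * minSeq F l v) ^ 2 := by
          gcongr with k
          refine (sqNorm_functional_le v (B (y k))).trans ?_
          gcongr
          exact (B.le_opNorm _).trans (mul_le_of_le_one_left (norm_nonneg _) hB)
      _ = sqNorm y * minSeq F l v ^ 2 := by simp [sqNorm, mul_pow, Finset.sum_mul]
      _ ≤ _ := by rw [mul_pow]; gcongr
  refine le_of_tendsto_of_tendsto' (b := Filter.atTop) tendsto_const_nhds
    (g := fun k : ℕ => ((maxSeq E n x + 1 / ((k : ℝ) + 1)) * minSeq F l v) ^ 2) ?_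
    (fun k => key _ ?_)
  · have h1 := tendsto_one_div_add_atTop_nhds_zero_nat (𝕜 := ℝ)
    have := (((h1.const_add (maxSeq E n x)).mul_const (minSeq F l v)).pow 2)
    simpa using this
  · have : 0 < 1 / ((k : ℝ) + 1) := by positivity
    linarith

/-- Cauchy–Schwarz for `(ξ α) y`. This bounds `COL E 1` below by the norm of `E`. -/
lemma minSeq_le_maxSeq {n : ℕ} (x : Fin n → E) : minSeq E n x ≤ maxSeq E n x := by
  refine minSeq_le (maxSeq_nonneg x) fun ξ => ?_
  refine le_of_forall_gt_imp_ge_of_dense fun c hc => ?_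
  rcases (Real.sqrt_nonneg (sqNorm ξ)).eq_or_lt with h0 | h0
  · rw [← h0, mul_zero] at hc
    have h1 : sqNorm ξ = 0 := (Real.sqrt_eq_zero (sqNorm_nonneg _)).1 h0.symm
    have h2 : ∀ j, ξ j = 0 := fun j => by
      have := (Finset.sum_eq_zero_iff_of_nonneg (fun i _ => sq_nonneg ‖ξ i‖)).1 h1 j (by simp)
      simpa using this
    simpa [h2] using hc.le
  · rw [← lt_div_iff₀ h0] at hc
    obtain ⟨m, α, y, hx, hα, hy⟩ := exists_of_maxSeq_lt hc
    have e1 : ∑ j, ξ j • x j = ∑ k, (∑ j, ξ j * α j k) • y k := by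
      simp only [hx, Finset.smul_sum, Finset.sum_smul, smul_smul]
      exact Finset.sum_comm
    have h3 : sqNorm (fun k => ∑ j, ξ j * α j k) ≤ sqNorm ξ :=
      (sqNorm_vecMul_le α ξ).trans
        (mul_le_of_le_one_left (sqNorm_nonneg _) (pow_le_one₀ (norm_nonneg _) hα))
    have hc0 : 0 ≤ c / √(sqNorm ξ) := (maxSeq_nonneg x).trans hc.le
    rw [e1]
    have hc1 : 0 ≤ c := (div_nonneg_iff.1 hc0).elim (fun h => h.1) fun h => absurd h.2 (not_le.2 h0)
    refine (pow_le_pow_iff_left₀ (norm_nonneg _) hc1 two_ne_zero).1 ?_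
    calc _ ≤ (∑ k, ‖∑ j, ξ j * α j k‖ * ‖y k‖) ^ 2 := by
          gcongr
          exact (norm_sum_le _ _).trans_eq (by simp [norm_smul])
      _ ≤ sqNorm (fun k => ∑ j, ξ j * α j k) * sqNorm y := Finset.sum_mul_sq_le_sq_mul_sq _ _ _
      _ ≤ sqNorm ξ * (c / √(sqNorm ξ)) ^ 2 := by
          have := sqNorm_nonneg ξ
          have := sqNorm_nonneg y
          gcongr
      _ = c ^ 2 := by
          rw [div_pow, Real.sq_sqrt (sqNorm_nonneg _)]
          have : sqNorm ξ ≠ 0 := (Real.sqrt_pos.1 h0).ne'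
          field_simp

end General

/-! ### Suprema over unit balls with values in `[0, ∞]` -/

section MapNorm

variable {X Y : Type*} {p : X → ℝ} {q : Y → ℝ} {T : X → Y}

lemma mapNorm_le {C : ℝ} (h : ∀ x, p x ≤ 1 → q (T x) ≤ C) : mapNorm p q T ≤ ENNReal.ofReal C :=
  iSup₂_le fun x hx => ENNReal.ofReal_le_ofReal (h x hx)

lemma le_mapNorm {x : X} (hx : p x ≤ 1) : ENNReal.ofReal (q (T x)) ≤ mapNorm p q T :=
  le_iSup₂ (f := fun x (_ : p x ≤ 1) => ENNReal.ofReal (q (T x))) x hx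

lemma le_toReal_mapNorm {x : X} (hx : p x ≤ 1) (hT : mapNorm p q T ≠ ∞) :
    q (T x) ≤ (mapNorm p q T).toReal :=
  (ENNReal.ofReal_le_iff_le_toReal hT).1 (le_mapNorm hx)

end MapNorm

section General

variable {E : Type*} [NormedAddCommGroup E] [NormedSpace ℂ E]

/-! ### The column operator space -/

lemma maxSeq_sum_smul_le {n m : ℕ} (x : Fin m → Fin n → E) (ξ : Fin m → ℂ) :
    maxSeq E n (∑ k, ξ k • x k) ≤ ∑ k, ‖ξ k‖ * maxSeq E n (x k) := by
  refine (Finset.le_sum_of_subadditive (maxSeq E n) maxSeq_zero.le maxSeq_add _ _).trans ?_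
  gcongr
  exact maxSeq_smul_le _ _

lemma applyVec_eq_sum {n : ℕ} (x : Matrix (Fin n) (Fin n) E) (ξ : EuclideanSpace ℂ (Fin n)) :
    applyVec x ξ = ∑ k, ξ k • fun i => x i k := by
  ext i; simp [applyVec]

lemma COL_nonneg {n : ℕ} (x : Matrix (Fin n) (Fin n) E) : 0 ≤ COL E n x := ENNReal.toReal_nonneg

lemma COL_le {n : ℕ} {x : Matrix (Fin n) (Fin n) E} {C : ℝ} (hC : 0 ≤ C)
    (h : ∀ ξ : Fin n → ℂ, maxSeq E n (fun i => ∑ k, ξ k • x i k) ≤ C * √(sqNorm ξ)) :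
    COL E n x ≤ C := by
  refine ENNReal.toReal_le_of_le_ofReal hC (mapNorm_le fun ξ hξ => ?_)
  refine (h ξ.ofLp).trans (mul_le_of_le_one_right hC ?_)
  rwa [sqrt_sqNorm]

lemma maxSeq_applyVec_le {n : ℕ} (x : Matrix (Fin n) (Fin n) E) (ξ : Fin n → ℂ) :
    maxSeq E n (fun i => ∑ k, ξ k • x i k) ≤ COL E n x * √(sqNorm ξ) := by
  -- Since `toReal` sends `∞` to `0`, finiteness comes first; the norms of the columns of `x` bound
  -- the supremum.
  have hfin : mapNorm (fun ξ : EuclideanSpace ℂ (Fin n) => ‖ξ‖) (maxSeq E n) (applyVec x) ≠ ∞ := by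
    refine ne_top_of_le_ne_top ENNReal.ofReal_ne_top
      (mapNorm_le (C := ∑ k, maxSeq E n (fun i => x i k)) fun ξ hξ => ?_)
    rw [applyVec_eq_sum]
    refine (maxSeq_sum_smul_le _ _).trans ?_
    gcongr with k
    exact mul_le_of_le_one_left (maxSeq_nonneg _) ((PiLp.norm_apply_le ξ k).trans hξ)
  have key : ∀ η : EuclideanSpace ℂ (Fin n), ‖η‖ ≤ 1 → maxSeq E n (applyVec x η) ≤ COL E n x :=
    fun η hη => le_toReal_mapNorm (p := fun ξ : EuclideanSpace ℂ (Fin n) => ‖ξ‖) hη hfin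
  rw [sqrt_sqNorm]
  set η : EuclideanSpace ℂ (Fin n) := WithLp.toLp 2 ξ with hη
  have e0 : (fun i => ∑ k, ξ k • x i k) = applyVec x η := rfl
  rw [e0]
  rcases eq_or_ne η 0 with h0 | h0
  · have : applyVec x η = 0 := by ext i; simp [applyVec, h0]
    rw [this, h0, maxSeq_zero]; simp
  · have hp : 0 < ‖η‖ := norm_pos_iff.2 h0
    have h1 := key ((‖η‖⁻¹ : ℂ) • η) (by rw [norm_smul]; simp [hp.ne'])
    have e1 : applyVec x η = (‖η‖ : ℂ) • applyVec x ((‖η‖⁻¹ : ℂ) • η) := by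
      ext i
      have : (‖η‖ : ℂ) ≠ 0 := by exact_mod_cast hp.ne'
      simp [applyVec, Finset.smul_sum, smul_smul, mul_inv_cancel_left₀ this]
    rw [e1]
    refine (maxSeq_smul_le _ _).trans ?_
    rw [Complex.norm_real, norm_norm, mul_comm]
    gcongr

lemma COL_add {n : ℕ} (x y : Matrix (Fin n) (Fin n) E) :
    COL E n (x + y) ≤ COL E n x + COL E n y := by
  refine COL_le (add_nonneg (COL_nonneg _) (COL_nonneg _)) fun ξ => ?_
  have e : (fun i => ∑ k, ξ k • (x + y) i k)
      = (fun i => ∑ k, ξ k • x i k) + fun i => ∑ k, ξ k • y i k := by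
    ext i; simp [Finset.sum_add_distrib]
  rw [e, add_mul]
  exact (maxSeq_add _ _).trans (add_le_add (maxSeq_applyVec_le _ _) (maxSeq_applyVec_le _ _))

lemma COL_mul_le {m n : ℕ} (α : Matrix (Fin n) (Fin m) ℂ) (x : Matrix (Fin m) (Fin m) E)
    (β : Matrix (Fin m) (Fin n) ℂ) :
    COL E n (rmul (lmul α x) β) ≤ ‖α‖ * COL E m x * ‖β‖ := by
  have h0 := COL_nonneg x
  refine COL_le (by positivity) fun ξ => ?_
  have e : (fun i => ∑ k, ξ k • rmul (lmul α x) β i k)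
      = colMul α (fun i => ∑ k, (∑ j, β k j * ξ j) • x i k) := by
    ext i
    simp only [rmul, lmul, colMul, Matrix.of_apply, Finset.smul_sum, Finset.sum_smul, smul_smul]
    rw [Finset.sum_comm]
    refine (Finset.sum_congr rfl fun _ _ => Finset.sum_comm).trans ?_
    rw [Finset.sum_comm]
    refine Finset.sum_congr rfl fun _ _ => Finset.sum_congr rfl fun _ _ =>
      Finset.sum_congr rfl fun _ _ => ?_
    congr 1; ring
  rw [e]
  refine (maxSeq_colMul_le _ _).trans ?_
  rw [mul_assoc, mul_assoc]
  gcongr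
  refine (maxSeq_applyVec_le _ _).trans ?_
  gcongr
  refine (Real.sqrt_le_sqrt (sqNorm_mulVec_le β ξ)).trans_eq ?_
  rw [Real.sqrt_mul (by positivity), Real.sqrt_sq (norm_nonneg _)]

lemma COL_one (x : Matrix (Fin 1) (Fin 1) E) : COL E 1 x = ‖x 0 0‖ := by
  refine le_antisymm (COL_le (norm_nonneg _) fun ξ => ?_) ?_
  · refine (maxSeq_le_sqrt _).trans_eq ?_
    simp only [sqNorm, norm_smul, Finset.univ_unique, Fin.default_eq_zero, Finset.sum_singleton]
    rw [mul_comm, Real.sqrt_sq (by positivity), Real.sqrt_sq (by positivity)]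
  · have h1 := (norm_sum_smul_le_minSeq (fun i => ∑ k, (1 : Fin 1 → ℂ) k • x i k) 1).trans
      (mul_le_mul_of_nonneg_right ((minSeq_le_maxSeq _).trans (maxSeq_applyVec_le _ _))
        (Real.sqrt_nonneg _))
    simpa [sqNorm] using h1

/-- Columns of `max(E)` may be concatenated. -/
lemma maxSeq_append_le {m n : ℕ} (x : Fin m → E) (y : Fin n → E) {s t : ℝ}
    (hs : maxSeq E m x < s) (ht : maxSeq E n y < t) :
    maxSeq E (m + n) (fun i => Sum.elim x y (finSumFinEquiv.symm i)) ≤ √(s ^ 2 + t ^ 2) := by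
  obtain ⟨k, α, u, hx, hα, hu⟩ := exists_of_maxSeq_lt hs
  obtain ⟨l, β, v, hy, hβ, hv⟩ := exists_of_maxSeq_lt ht
  have key := maxSeq_le (x := fun i => Sum.elim x y (finSumFinEquiv.symm i)) (κ := Fin k ⊕ Fin l)
    ((Matrix.fromBlocks α 0 0 β).submatrix finSumFinEquiv.symm id) (Sum.elim u v)
    (a := 1) (b := √(s ^ 2 + t ^ 2)) (fun i => ?_) ?_ (Real.sqrt_nonneg _) ?_
  · simpa using key
  · rcases h : finSumFinEquiv.symm i with i | i <;> simp [h, hx, hy]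
  · refine norm_le_of_mulVec zero_le_one fun ξ => ?_
    have h1 := sqNorm_mulVec_le α (fun k => ξ (Sum.inl k))
    have h2 := sqNorm_mulVec_le β (fun k => ξ (Sum.inr k))
    have h3 : ‖α‖ ^ 2 ≤ 1 := pow_le_one₀ (norm_nonneg _) hα
    have h4 : ‖β‖ ^ 2 ≤ 1 := pow_le_one₀ (norm_nonneg _) hβ
    have e1 : sqNorm ξ = sqNorm (fun k => ξ (Sum.inl k)) + sqNorm (fun k => ξ (Sum.inr k)) := by
      simp [sqNorm]
    have h5 := sqNorm_nonneg (fun k => ξ (Sum.inl k))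
    have h6 := sqNorm_nonneg (fun k => ξ (Sum.inr k))
    have e2 : sqNorm (fun i => ∑ k, (Matrix.fromBlocks α 0 0 β).submatrix
        (finSumFinEquiv (m := m) (n := n)).symm id i k * ξ k)
        = sqNorm (fun i => ∑ k, α i k * ξ (Sum.inl k))
          + sqNorm (fun i => ∑ k, β i k * ξ (Sum.inr k)) := by
      refine (finSumFinEquiv.symm.sum_comp
        (fun i => ‖∑ k, Matrix.fromBlocks α 0 0 β i k * ξ k‖ ^ 2)).trans ?_
      simp [sqNorm]
    rw [e2, e1]
    nlinarith
  · rw [Real.sq_sqrt (by positivity)]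
    simp only [sqNorm, Fintype.sum_sum_type, Sum.elim_inl, Sum.elim_inr]
    exact add_le_add hu hv

lemma dirSum_apply {V : Type*} [AddCommGroup V] {m n : ℕ} (x : Matrix (Fin m) (Fin m) V)
    (y : Matrix (Fin n) (Fin n) V)
    (i j : Fin (m + n)) : dirSum x y i j
      = Matrix.fromBlocks x 0 0 y (finSumFinEquiv.symm i) (finSumFinEquiv.symm j) := rfl

/-- Both `ξ` and the column `x ξ` split into two orthogonal pieces, to which `maxSeq_append_le`
applies. The strict bounds it asks for are reached by adding `ε`. -/
lemma COL_dirSum_le {m n : ℕ} (x : Matrix (Fin m) (Fin m) E) (y : Matrix (Fin n) (Fin n) E) :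
    COL E (m + n) (dirSum x y) ≤ max (COL E m x) (COL E n y) := by
  have hM : 0 ≤ max (COL E m x) (COL E n y) := le_max_of_le_left (COL_nonneg x)
  refine COL_le hM fun ξ => ?_
  set ξ₁ : Fin m → ℂ := fun k => ξ (finSumFinEquiv (Sum.inl k)) with h₁
  set ξ₂ : Fin n → ℂ := fun k => ξ (finSumFinEquiv (Sum.inr k)) with h₂
  have e1 : sqNorm ξ = sqNorm ξ₁ + sqNorm ξ₂ := by
    refine (finSumFinEquiv.sum_comp (fun k => ‖ξ k‖ ^ 2)).symm.trans ?_
    simp only [sqNorm, Fintype.sum_sum_type, h₁, h₂]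
  have e2 : (fun i => ∑ k, ξ k • dirSum x y i k) = fun i =>
      Sum.elim (fun i => ∑ k, ξ₁ k • x i k) (fun i => ∑ k, ξ₂ k • y i k)
        (finSumFinEquiv.symm i) := by
    ext i
    refine (finSumFinEquiv.sum_comp (fun k => ξ k • dirSum x y i k)).symm.trans ?_
    simp only [dirSum_apply, Equiv.symm_apply_apply, Fintype.sum_sum_type]
    rcases finSumFinEquiv.symm i with i | i <;> simp [ξ₁, ξ₂]
  rw [e2]
  have hx := maxSeq_applyVec_le x ξ₁
  have hy := maxSeq_applyVec_le y ξ₂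
  set M := max (COL E m x) (COL E n y)
  have hx' : maxSeq E m (fun i => ∑ k, ξ₁ k • x i k) ≤ M * √(sqNorm ξ₁) :=
    hx.trans (by gcongr; exact le_max_left _ _)
  have hy' : maxSeq E n (fun i => ∑ k, ξ₂ k • y i k) ≤ M * √(sqNorm ξ₂) :=
    hy.trans (by gcongr; exact le_max_right _ _)
  have key : ∀ ε > 0, maxSeq E (m + n) (fun i =>
      Sum.elim (fun i => ∑ k, ξ₁ k • x i k) (fun i => ∑ k, ξ₂ k • y i k) (finSumFinEquiv.symm i))
      ≤ √((M * √(sqNorm ξ₁) + ε) ^ 2 + (M * √(sqNorm ξ₂) + ε) ^ 2) := fun ε hε =>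
    maxSeq_append_le _ _ (by linarith) (by linarith)
  have hlim : Filter.Tendsto (fun ε : ℝ =>
      √((M * √(sqNorm ξ₁) + ε) ^ 2 + (M * √(sqNorm ξ₂) + ε) ^ 2)) (nhdsWithin 0 (Set.Ioi 0))
      (nhds √((M * √(sqNorm ξ₁) + 0) ^ 2 + (M * √(sqNorm ξ₂) + 0) ^ 2)) :=
    tendsto_nhdsWithin_of_tendsto_nhds (Continuous.tendsto (by fun_prop) 0)
  refine (ge_of_tendsto hlim (Filter.eventually_of_mem self_mem_nhdsWithin key)).trans_eq ?_
  rw [add_zero, add_zero, mul_pow, mul_pow, Real.sq_sqrt (sqNorm_nonneg _),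
    Real.sq_sqrt (sqNorm_nonneg _), ← mul_add, ← e1, Real.sqrt_mul (by positivity), Real.sqrt_sq hM]

lemma COL_map_le {F : Type*} [NormedAddCommGroup F] [NormedSpace ℂ F] (T : E →L[ℂ] F) {n : ℕ}
    (x : Matrix (Fin n) (Fin n) E) : COL F n (x.map T) ≤ ‖T‖ * COL E n x := by
  refine COL_le (mul_nonneg (norm_nonneg _) (COL_nonneg x)) fun ξ => ?_
  have e : (fun i => ∑ k, ξ k • x.map T i k) = fun i => T (∑ k, ξ k • x i k) := by
    ext i; simp
  rw [e, mul_assoc]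
  refine (maxSeq_map_le _ _).trans ?_
  gcongr
  exact maxSeq_applyVec_le _ _

/-! ### The row operator space -/

lemma ROW_nonneg {n : ℕ} (x : Matrix (Fin n) (Fin n) E) : 0 ≤ ROW E n x := by
  refine Real.sInf_nonneg ?_
  rintro _ ⟨k, l, α, v, β, -, -, rfl⟩
  positivity

lemma rmul_lmul_blockDiag {n k l : ℕ} (α : Matrix (Fin n) (Fin k × Fin l) ℂ)
    (v : Fin k → Fin l → E) (β : Matrix (Fin k) (Fin n) ℂ) (i j : Fin n) :
    rmul (lmul α (blockDiag v)) β i j = ∑ a, ∑ p, (β a j * α i (a, p)) • v a p := by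
  simp only [rmul, lmul, blockDiag, Matrix.of_apply, Finset.smul_sum, Fintype.sum_prod_type,
    smul_ite, smul_zero, smul_smul]
  refine Finset.sum_congr rfl fun a _ => ?_
  rw [Finset.sum_comm]
  refine Finset.sum_congr rfl fun p _ => ?_
  simp

/-- As in `maxSeq_le`, general index types allow factorizations to be placed in blocks over sum
types. -/
lemma ROW_le {κ ℓ : Type*} [Fintype κ] [DecidableEq κ] [Fintype ℓ] [DecidableEq ℓ] {n : ℕ}
    {x : Matrix (Fin n) (Fin n) E} (α : Matrix (Fin n) (κ × ℓ) ℂ) (v : κ → ℓ → E)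
    (β : Matrix κ (Fin n) ℂ) {a b : ℝ}
    (hv : ∀ k (ξ : ℓ → ℂ), ‖∑ p, ξ p • v k p‖ ≤ √(sqNorm ξ))
    (hx : ∀ i j, x i j = ∑ k, ∑ p, (β k j * α i (k, p)) • v k p)
    (hα : ‖α‖ ≤ a) (hβ : ‖β‖ ≤ b) : ROW E n x ≤ a * b := by
  let e := Fintype.equivFin κ
  let f := Fintype.equivFin ℓ
  have ha : 0 ≤ a := (norm_nonneg _).trans hα
  have hb : 0 ≤ b := (norm_nonneg _).trans hβ
  have h1 : ‖α.submatrix id (Prod.map e.symm f.symm)‖ ≤ a := by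
    refine norm_le_of_vecMul ha fun ξ => ?_
    calc _ = sqNorm (fun k => ∑ i, ξ i * α i k) :=
          (e.symm.prodCongr f.symm).sum_comp (fun k => ‖∑ i, ξ i * α i k‖ ^ 2)
      _ ≤ ‖α‖ ^ 2 * sqNorm ξ := sqNorm_vecMul_le _ _
      _ ≤ _ := by gcongr; exact sqNorm_nonneg _
  have h2 : ‖β.submatrix e.symm id‖ ≤ b := by
    refine norm_le_of_mulVec hb fun ξ => ?_
    calc _ = sqNorm (fun k => ∑ i, β k i * ξ i) :=
          e.symm.sum_comp (fun k => ‖∑ i, β k i * ξ i‖ ^ 2)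
      _ ≤ ‖β‖ ^ 2 * sqNorm ξ := sqNorm_mulVec_le _ _
      _ ≤ _ := by gcongr; exact sqNorm_nonneg _
  unfold ROW MaxOp
  refine (csInf_le (a := ‖α.submatrix id (Prod.map e.symm f.symm)‖ * ‖β.submatrix e.symm id‖)
    ⟨0, ?_⟩ ?_).trans (by gcongr)
  · rintro _ ⟨k, l, α, v, β, -, -, rfl⟩
    positivity
  · refine ⟨_, _, α.submatrix id (Prod.map e.symm f.symm), fun k p => v (e.symm k) (f.symm p),
      β.submatrix e.symm id, fun k => minSeq_le zero_le_one fun ξ => ?_, ?_, rfl⟩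
    · have := hv (e.symm k) (fun p => ξ (f p))
      rw [one_mul]
      refine (le_of_eq ?_).trans (this.trans_eq ?_)
      · rw [← f.sum_comp]; simp
      · congr 1; exact f.sum_comp (fun p => ‖ξ p‖ ^ 2)
    · ext i j
      rw [rmul_lmul_blockDiag, hx, ← e.symm.sum_comp]
      refine Finset.sum_congr rfl fun k _ => ?_
      rw [← f.symm.sum_comp]
      rfl

/-- The infimum runs over a nonempty set: `x` is cut into columns divided by `S + 1`, where `S` is
the sum of all `‖x i j‖`. This puts each column in the unit ball of min(E), and the summand `1`
keeps the scalar invertible when `x = 0`. -/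
lemma exists_ROW_factorization {n : ℕ} (x : Matrix (Fin n) (Fin n) E) :
    ∃ (r : ℝ) (k l : ℕ) (α : Matrix (Fin n) (Fin k × Fin l) ℂ)
      (v : Fin k → Fin l → E) (β : Matrix (Fin k) (Fin n) ℂ),
      (∀ i, minSeq E l (v i) ≤ 1) ∧ x = rmul (lmul α (blockDiag v)) β ∧ r = ‖α‖ * ‖β‖ := by
  refine ⟨_, n, n * n, Matrix.of fun i q => if q.2 = finProdFinEquiv (i, q.1) then
    ((∑ i, ∑ j, ‖x i j‖ + 1 : ℝ) : ℂ) else 0, fun k p => ((∑ i, ∑ j, ‖x i j‖ + 1 : ℝ) : ℂ)⁻¹ •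
      if (finProdFinEquiv.symm p).2 = k then x (finProdFinEquiv.symm p).1 k else 0, 1,
      fun k => ?_, ?_, rfl⟩
  · set S := ∑ i, ∑ j, ‖x i j‖ with hS
    have hS0 : 0 ≤ S := by positivity
    refine minSeq_le zero_le_one fun ξ => ?_
    simp only [smul_comm (ξ _), ← Finset.smul_sum]
    rw [norm_smul, norm_inv, Complex.norm_real, Real.norm_of_nonneg (by positivity),
      inv_mul_le_iff₀ (by positivity), one_mul]
    rw [← finProdFinEquiv.sum_comp, Fintype.sum_prod_type]
    simp only [Equiv.symm_apply_apply, smul_ite, smul_zero, Finset.sum_ite_eq', Finset.mem_univ,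
      if_true]
    have h1 : ∀ q, ‖ξ q‖ ≤ √(sqNorm ξ) := fun q => by
      rw [sqrt_sqNorm]; exact PiLp.norm_apply_le (WithLp.toLp 2 ξ) q
    calc _ ≤ ∑ i, √(sqNorm ξ) * ‖x i k‖ := by
          refine (norm_sum_le _ _).trans ?_
          gcongr
          rw [norm_smul]
          gcongr
          exact h1 _
      _ = √(sqNorm ξ) * ∑ i, ‖x i k‖ := by rw [Finset.mul_sum]
      _ ≤ √(sqNorm ξ) * (S + 1) := by
          gcongr
          have : ∑ i, ‖x i k‖ ≤ S := by
            rw [hS]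
            gcongr with i
            exact Finset.single_le_sum (f := fun j => ‖x i j‖) (fun _ _ => norm_nonneg _)
              (Finset.mem_univ k)
          linarith
      _ = _ := mul_comm _ _
  · ext i j
    have hS : ((∑ i, ∑ j, ‖x i j‖ + 1 : ℝ) : ℂ) ≠ 0 := by
      have : 0 ≤ ∑ i, ∑ j, ‖x i j‖ := by positivity
      exact_mod_cast (by linarith : (0 : ℝ) < ∑ i, ∑ j, ‖x i j‖ + 1).ne'
    rw [rmul_lmul_blockDiag]
    set S : ℂ := ((∑ i, ∑ j, ‖x i j‖ + 1 : ℝ) : ℂ)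
    have e : ∀ g : Fin (n * n) → E, ∑ p, g p = ∑ i, ∑ j, g (finProdFinEquiv (i, j)) :=
      fun g => by rw [← finProdFinEquiv.sum_comp, Fintype.sum_prod_type]
    simp only [e]
    simp [Matrix.one_apply, smul_smul, hS, -finProdFinEquiv_apply_val]

lemma exists_of_ROW_lt {n : ℕ} {x : Matrix (Fin n) (Fin n) E} {t : ℝ} (h : ROW E n x < t) :
    ∃ (k l : ℕ) (α : Matrix (Fin n) (Fin k × Fin l) ℂ) (v : Fin k → Fin l → E)
      (β : Matrix (Fin k) (Fin n) ℂ), (∀ i, minSeq E l (v i) ≤ 1) ∧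
      (∀ i j, x i j = ∑ a, ∑ p, (β a j * α i (a, p)) • v a p) ∧ ‖α‖ ^ 2 ≤ t ∧ ‖β‖ ^ 2 ≤ t := by
  have ht : 0 < t := (ROW_nonneg x).trans_lt h
  unfold ROW MaxOp at h
  obtain ⟨_, ⟨k, l, α, v, β, hv, hx, rfl⟩, hr⟩ :=
    exists_lt_of_csInf_lt (by exact exists_ROW_factorization x) h
  rcases eq_or_ne α 0 with h0 | h0
  · refine ⟨k, l, 0, v, 0, hv, fun i j => ?_, by simpa using ht.le, by simpa using ht.le⟩
    rw [hx, rmul_lmul_blockDiag, h0]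
    simp
  · have hα : 0 < ‖α‖ := norm_pos_iff.2 h0
    have hs : 0 < √t := Real.sqrt_pos.2 ht
    have hα' : (‖α‖ : ℂ) ≠ 0 := by exact_mod_cast hα.ne'
    have hs' : (√t : ℂ) ≠ 0 := by exact_mod_cast hs.ne'
    -- A scalar moves between the factors: the new `‖α‖²` is `t`, and the new `‖β‖²` is `(‖α‖ ‖β‖)²
    -- / t`, which is at most `t`.
    refine ⟨k, l, ((√t : ℂ) / ‖α‖) • α, v, ((‖α‖ : ℂ) / √t) • β, hv, fun i j => ?_, ?_, ?_⟩
    · rw [hx, rmul_lmul_blockDiag]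
      refine Finset.sum_congr rfl fun a _ => Finset.sum_congr rfl fun p _ => ?_
      simp only [Matrix.smul_apply, smul_eq_mul]
      congr 1
      field_simp
    · rw [norm_smul, norm_div, Complex.norm_real, Complex.norm_real, norm_norm,
        Real.norm_of_nonneg hs.le, div_mul_cancel₀ _ hα.ne', Real.sq_sqrt ht.le]
    · rw [norm_smul, norm_div, Complex.norm_real, Complex.norm_real, norm_norm,
        Real.norm_of_nonneg hs.le, mul_pow, div_pow, Real.sq_sqrt ht.le, div_mul_eq_mul_div,
        div_le_iff₀ ht, ← mul_pow, ← sq]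
      gcongr

end General

/-! ### Ruan's axioms and functoriality for the row space; homogeneity -/

section General

variable {E : Type*} [NormedAddCommGroup E] [NormedSpace ℂ E]

/-- Balanced factorizations are joined over the disjoint union of their blocks, and the squared
norms of the factors add. Blocks share one length, so the columns are padded with zeros. -/
lemma ROW_add {n : ℕ} (x y : Matrix (Fin n) (Fin n) E) :
    ROW E n (x + y) ≤ ROW E n x + ROW E n y := by
  refine le_of_forall_pos_le_add fun ε hε => ?_
  set s := ROW E n x + ε / 2 with hs
  set t := ROW E n y + ε / 2 with ht
  have hs0 : 0 < s := by have := ROW_nonneg x; linarith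
  have ht0 : 0 < t := by have := ROW_nonneg y; linarith
  obtain ⟨k, l, α, v, β, hv, hx, hα, hβ⟩ := exists_of_ROW_lt (show ROW E n x < s by linarith)
  obtain ⟨k', l', α', v', β', hv', hy, hα', hβ'⟩ :=
    exists_of_ROW_lt (show ROW E n y < t by linarith)
  have key : ROW E n (x + y) ≤ √(s + t) * √(s + t) := by
    refine ROW_le (κ := Fin k ⊕ Fin k') (ℓ := Fin l ⊕ Fin l')
      (Matrix.of fun i q => Sum.elim (fun a => Sum.elim (fun p => α i (a, p)) 0 q.2)
        (fun a => Sum.elim 0 (fun p => α' i (a, p)) q.2) q.1)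
      (Sum.elim (fun a => Sum.elim (v a) 0) (fun a => Sum.elim 0 (v' a)))
      (Matrix.of fun a j => Sum.elim (fun a => β a j) (fun a => β' a j) a) (fun a ξ => ?_) (fun i j => ?_) ?_ ?_
    · rcases a with a | a
      · simp only [Fintype.sum_sum_type, Sum.elim_inl, Sum.elim_inr, Pi.zero_apply, smul_zero,
          Finset.sum_const_zero, add_zero]
        refine (norm_sum_smul_le_minSeq (v a) (fun p => ξ (Sum.inl p))).trans
          ((mul_le_of_le_one_left (Real.sqrt_nonneg _) (hv a)).trans (Real.sqrt_le_sqrt ?_))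
        simp only [sqNorm, Fintype.sum_sum_type]
        exact le_add_of_nonneg_right (by positivity)
      · simp only [Fintype.sum_sum_type, Sum.elim_inl, Sum.elim_inr, Pi.zero_apply, smul_zero,
          Finset.sum_const_zero, zero_add]
        refine (norm_sum_smul_le_minSeq (v' a) (fun p => ξ (Sum.inr p))).trans
          ((mul_le_of_le_one_left (Real.sqrt_nonneg _) (hv' a)).trans (Real.sqrt_le_sqrt ?_))
        simp only [sqNorm, Fintype.sum_sum_type]
        exact le_add_of_nonneg_left (by positivity)
    · simp [hx, hy]
    · refine norm_le_of_vecMul (by positivity) fun ξ => ?_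
      rw [Real.sq_sqrt (by positivity), add_mul]
      have h5 := sqNorm_nonneg ξ
      have h1 := (sqNorm_vecMul_le α ξ).trans (mul_le_mul_of_nonneg_right hα h5)
      have h2 := (sqNorm_vecMul_le α' ξ).trans (mul_le_mul_of_nonneg_right hα' h5)
      refine (le_of_eq ?_).trans (add_le_add h1 h2)
      simp [sqNorm, Fintype.sum_prod_type]
    · refine norm_le_of_mulVec (by positivity) fun ξ => ?_
      rw [Real.sq_sqrt (by positivity), add_mul]
      have h5 := sqNorm_nonneg ξ
      have h1 := (sqNorm_mulVec_le β ξ).trans (mul_le_mul_of_nonneg_right hβ h5)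
      have h2 := (sqNorm_mulVec_le β' ξ).trans (mul_le_mul_of_nonneg_right hβ' h5)
      refine (le_of_eq ?_).trans (add_le_add h1 h2)
      simp [sqNorm]
  rw [Real.mul_self_sqrt (by positivity)] at key
  linarith

lemma norm_sum_smul_le_of_minSeq_le_one {l : ℕ} {v : Fin l → E} (hv : minSeq E l v ≤ 1)
    (ξ : Fin l → ℂ) : ‖∑ p, ξ p • v p‖ ≤ √(sqNorm ξ) :=
  (norm_sum_smul_le_minSeq v ξ).trans (mul_le_of_le_one_left (Real.sqrt_nonneg _) hv)

lemma ROW_mul_le {m n : ℕ} (α : Matrix (Fin n) (Fin m) ℂ) (x : Matrix (Fin m) (Fin m) E)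
    (β : Matrix (Fin m) (Fin n) ℂ) :
    ROW E n (rmul (lmul α x) β) ≤ ‖α‖ * ROW E m x * ‖β‖ := by
  have key : ∀ t, ROW E m x < t → ROW E n (rmul (lmul α x) β) ≤ ‖α‖ * t * ‖β‖ := by
    intro t hxt
    have ht : 0 ≤ t := (ROW_nonneg x).trans hxt.le
    obtain ⟨k, l, γ, v, δ, hv, hx, hγ, hδ⟩ := exists_of_ROW_lt hxt
    refine (ROW_le (a := ‖α‖ * √t) (b := √t * ‖β‖) (α * γ) v (δ * β)
      (fun a => norm_sum_smul_le_of_minSeq_le_one (hv a)) (fun i j => ?_) ?_ ?_).trans_eq ?_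
    · simp only [rmul, lmul, Matrix.of_apply, hx, Finset.smul_sum, smul_smul, Matrix.mul_apply,
        Finset.sum_mul_sum, Finset.sum_smul]
      have e : ∀ g : Fin m → Fin m → Fin k → Fin l → E,
          ∑ b, ∑ a, ∑ c, ∑ p, g a b c p = ∑ c, ∑ p, ∑ a, ∑ b, g a b c p := by
        intro g
        calc _ = ∑ b, ∑ c, ∑ a, ∑ p, g a b c p :=
              Finset.sum_congr rfl fun _ _ => Finset.sum_comm
          _ = ∑ c, ∑ b, ∑ a, ∑ p, g a b c p := Finset.sum_comm
          _ = ∑ c, ∑ b, ∑ p, ∑ a, g a b c p := Finset.sum_congr rfl fun _ _ =>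
              Finset.sum_congr rfl fun _ _ => Finset.sum_comm
          _ = ∑ c, ∑ p, ∑ b, ∑ a, g a b c p :=
              Finset.sum_congr rfl fun _ _ => Finset.sum_comm
          _ = _ := Finset.sum_congr rfl fun _ _ => Finset.sum_congr rfl fun _ _ => Finset.sum_comm
      rw [e]
      refine Finset.sum_congr rfl fun _ _ => Finset.sum_congr rfl fun _ _ => ?_
      rw [Finset.sum_comm]
      refine Finset.sum_congr rfl fun _ _ => Finset.sum_congr rfl fun _ _ => ?_
      congr 1; ring
    · refine (Matrix.l2_opNorm_mul _ _).trans ?_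
      gcongr
      exact Real.le_sqrt_of_sq_le hγ
    · refine (Matrix.l2_opNorm_mul _ _).trans ?_
      gcongr
      exact Real.le_sqrt_of_sq_le hδ
    · rw [show ‖α‖ * √t * (√t * ‖β‖) = ‖α‖ * (√t * √t) * ‖β‖ by ring, Real.mul_self_sqrt ht]
  have hlim : Filter.Tendsto (fun t : ℝ => ‖α‖ * t * ‖β‖)
      (nhdsWithin (ROW E m x) (Set.Ioi (ROW E m x))) (nhds (‖α‖ * ROW E m x * ‖β‖)) :=
    tendsto_nhdsWithin_of_tendsto_nhds (Continuous.tendsto (by fun_prop) _)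
  exact ge_of_tendsto hlim (Filter.eventually_of_mem self_mem_nhdsWithin key)

lemma ROW_one (x : Matrix (Fin 1) (Fin 1) E) : ROW E 1 x = ‖x 0 0‖ := by
  refine le_antisymm ?_ (le_of_forall_gt_imp_ge_of_dense fun t ht => ?_)
  · refine (ROW_le (κ := Fin 1) (ℓ := Fin 1) (a := 1) (b := ‖x 0 0‖)
      (Matrix.of fun _ _ => 1) (fun _ _ => (‖x 0 0‖⁻¹ : ℂ) • x 0 0)
      (Matrix.of fun _ _ => (‖x 0 0‖ : ℂ)) (fun _ ξ => ?_) (fun i j => ?_) ?_ ?_).trans_eq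
        (one_mul _)
    · simp only [sqNorm, Finset.univ_unique, Fin.default_eq_zero, Finset.sum_singleton, norm_smul,
        Real.sqrt_sq (norm_nonneg _)]
      refine mul_le_of_le_one_right (norm_nonneg _) ?_
      rw [norm_inv, Complex.norm_real, norm_norm]
      exact inv_mul_le_one
    · fin_cases i; fin_cases j
      rcases eq_or_ne (x 0 0) 0 with h | h
      · simp [h]
      · have : (‖x 0 0‖ : ℂ) ≠ 0 := by exact_mod_cast (norm_pos_iff.2 h).ne'
        simp [smul_smul, this]
    · refine norm_le_of_vecMul zero_le_one fun ξ => ?_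
      simp [sqNorm]
    · refine norm_le_of_mulVec (norm_nonneg _) fun ξ => ?_
      simp [sqNorm, mul_pow]
  · obtain ⟨k, l, α, v, β, hv, hx, hα, hβ⟩ := exists_of_ROW_lt ht
    have ht0 : 0 ≤ t := (ROW_nonneg x).trans ht.le
    rw [hx]
    have h1 := (sqNorm_vecMul_le α 1).trans (mul_le_mul_of_nonneg_right hα (sqNorm_nonneg 1))
    have h2 := (sqNorm_mulVec_le β 1).trans (mul_le_mul_of_nonneg_right hβ (sqNorm_nonneg 1))
    simp only [sqNorm, Finset.univ_unique, Fin.default_eq_zero, Pi.one_apply, one_mul, mul_one,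
      Finset.sum_singleton, norm_one, one_pow] at h1 h2
    have h3 : ∀ a, ‖∑ p, (β a 0 * α 0 (a, p)) • v a p‖ ≤ ‖β a 0‖ * √(∑ p, ‖α 0 (a, p)‖ ^ 2) := by
      intro a
      simp only [mul_smul, ← Finset.smul_sum]
      rw [norm_smul]
      gcongr
      exact norm_sum_smul_le_of_minSeq_le_one (hv a) _
    refine (norm_sum_le _ _).trans ((Finset.sum_le_sum fun a _ => h3 a).trans ?_)
    refine (pow_le_pow_iff_left₀ (by positivity) ht0 two_ne_zero).1 ?_
    refine (Finset.sum_mul_sq_le_sq_mul_sq _ _ _).trans ?_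
    rw [sq t]
    have e : ∑ a, √(∑ p, ‖α 0 (a, p)‖ ^ 2) ^ 2 = ∑ q, ‖α 0 q‖ ^ 2 := by
      rw [Fintype.sum_prod_type]
      exact Finset.sum_congr rfl fun a _ => Real.sq_sqrt (by positivity)
    rw [e]
    gcongr

/-- The blocks are joined as in `ROW_add`, but now they act on orthogonal rows and columns, so the
common bound `t` on the squared norms persists instead of doubling. -/
lemma ROW_dirSum_le {m n : ℕ} (x : Matrix (Fin m) (Fin m) E) (y : Matrix (Fin n) (Fin n) E) :
    ROW E (m + n) (dirSum x y) ≤ max (ROW E m x) (ROW E n y) := by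
  refine le_of_forall_gt_imp_ge_of_dense fun t ht => ?_
  obtain ⟨hxt, hyt⟩ := max_lt_iff.1 ht
  have ht0 : 0 ≤ t := (ROW_nonneg x).trans hxt.le
  obtain ⟨k, l, α, v, β, hv, hx, hα, hβ⟩ := exists_of_ROW_lt hxt
  obtain ⟨k', l', α', v', β', hv', hy, hα', hβ'⟩ := exists_of_ROW_lt hyt
  refine (ROW_le (a := √t) (b := √t) (κ := Fin k ⊕ Fin k') (ℓ := Fin l ⊕ Fin l')
    (Matrix.of fun i q =>
      Sum.elim (fun a => Sum.elim (fun p => Sum.elim (fun i => α i (a, p)) 0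
          (finSumFinEquiv.symm i)) 0 q.2)
        (fun a => Sum.elim 0 (fun p => Sum.elim 0 (fun i => α' i (a, p))
          (finSumFinEquiv.symm i)) q.2) q.1)
    (Sum.elim (fun a => Sum.elim (v a) 0) (fun a => Sum.elim 0 (v' a)))
    ((Matrix.fromBlocks β 0 0 β').submatrix id finSumFinEquiv.symm)
    (fun a ξ => ?_) (fun i j => ?_) ?_ ?_).trans_eq (Real.mul_self_sqrt ht0)
  · rcases a with a | a
    · simp only [Fintype.sum_sum_type, Sum.elim_inl, Sum.elim_inr, Pi.zero_apply, smul_zero,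
        Finset.sum_const_zero, add_zero]
      refine (norm_sum_smul_le_of_minSeq_le_one (hv a) (fun p => ξ (Sum.inl p))).trans
        (Real.sqrt_le_sqrt ?_)
      simp only [sqNorm, Fintype.sum_sum_type]
      exact le_add_of_nonneg_right (by positivity)
    · simp only [Fintype.sum_sum_type, Sum.elim_inl, Sum.elim_inr, Pi.zero_apply, smul_zero,
        Finset.sum_const_zero, zero_add]
      refine (norm_sum_smul_le_of_minSeq_le_one (hv' a) (fun p => ξ (Sum.inr p))).trans
        (Real.sqrt_le_sqrt ?_)
      simp only [sqNorm, Fintype.sum_sum_type]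
      exact le_add_of_nonneg_left (by positivity)
  · rw [dirSum_apply]
    rcases hi : finSumFinEquiv.symm i with i | i <;>
      rcases hj : finSumFinEquiv.symm j with j | j <;> simp [hi, hj, hx, hy]
  · refine norm_le_of_vecMul (Real.sqrt_nonneg t) fun ξ => ?_
    rw [Real.sq_sqrt ht0]
    have h1 := (sqNorm_vecMul_le α (fun i => ξ (finSumFinEquiv (Sum.inl i)))).trans
      (mul_le_mul_of_nonneg_right hα (sqNorm_nonneg _))
    have h2 := (sqNorm_vecMul_le α' (fun i => ξ (finSumFinEquiv (Sum.inr i)))).trans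
      (mul_le_mul_of_nonneg_right hα' (sqNorm_nonneg _))
    have e1 : sqNorm ξ = sqNorm (fun k => ξ (finSumFinEquiv (Sum.inl k)))
        + sqNorm (fun k => ξ (finSumFinEquiv (Sum.inr k))) := by
      refine (finSumFinEquiv.sum_comp (fun k => ‖ξ k‖ ^ 2)).symm.trans ?_
      simp only [sqNorm, Fintype.sum_sum_type]
    rw [e1, mul_add]
    refine (le_of_eq ?_).trans (add_le_add h1 h2)
    simp [sqNorm, Fintype.sum_prod_type, ← finSumFinEquiv.sum_comp]
  · refine norm_le_of_mulVec (Real.sqrt_nonneg t) fun ξ => ?_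
    rw [Real.sq_sqrt ht0]
    have h1 := (sqNorm_mulVec_le β (fun i => ξ (finSumFinEquiv (Sum.inl i)))).trans
      (mul_le_mul_of_nonneg_right hβ (sqNorm_nonneg _))
    have h2 := (sqNorm_mulVec_le β' (fun i => ξ (finSumFinEquiv (Sum.inr i)))).trans
      (mul_le_mul_of_nonneg_right hβ' (sqNorm_nonneg _))
    have e1 : sqNorm ξ = sqNorm (fun k => ξ (finSumFinEquiv (Sum.inl k)))
        + sqNorm (fun k => ξ (finSumFinEquiv (Sum.inr k))) := by
      refine (finSumFinEquiv.sum_comp (fun k => ‖ξ k‖ ^ 2)).symm.trans ?_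
      simp only [sqNorm, Fintype.sum_sum_type]
    rw [e1, mul_add]
    refine (le_of_eq ?_).trans (add_le_add h1 h2)
    simp [sqNorm, ← finSumFinEquiv.sum_comp]

lemma ROW_map_le {F : Type*} [NormedAddCommGroup F] [NormedSpace ℂ F] (T : E →L[ℂ] F) {n : ℕ}
    (x : Matrix (Fin n) (Fin n) E) : ROW F n (x.map T) ≤ ‖T‖ * ROW E n x := by
  -- A strict majorant `c` of `‖T‖` is invertible even if `T = 0`; then `c⁻¹ T v` stays in the unit
  -- ball and `c` passes to the left factor.
  have key : ∀ c, ‖T‖ < c → ∀ t, ROW E n x < t → ROW F n (x.map T) ≤ c * t := by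
    intro c hc t hxt
    have hc0 : 0 < c := (norm_nonneg _).trans_lt hc
    have ht : 0 ≤ t := (ROW_nonneg x).trans hxt.le
    obtain ⟨k, l, γ, v, δ, hv, hx, hγ, hδ⟩ := exists_of_ROW_lt hxt
    refine (ROW_le (a := c * √t) (b := √t) ((c : ℂ) • γ) (fun a p => (c : ℂ)⁻¹ • T (v a p)) δ
      (fun a ξ => ?_) (fun i j => ?_) ?_ (Real.le_sqrt_of_sq_le hδ)).trans_eq ?_
    · have e : ∑ p, ξ p • (c : ℂ)⁻¹ • T (v a p) = (c : ℂ)⁻¹ • T (∑ p, ξ p • v a p) := by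
        simp only [map_sum, map_smul, Finset.smul_sum, smul_comm (c : ℂ)⁻¹]
      rw [e, norm_smul, norm_inv, Complex.norm_real, Real.norm_of_nonneg hc0.le,
        inv_mul_le_iff₀ hc0]
      refine (T.le_opNorm _).trans ?_
      gcongr
      exact norm_sum_smul_le_of_minSeq_le_one (hv a) _
    · have : (c : ℂ) ≠ 0 := by exact_mod_cast hc0.ne'
      simp only [Matrix.map_apply, hx, map_sum, map_smul, Matrix.smul_apply, smul_eq_mul, smul_smul]
      refine Finset.sum_congr rfl fun _ _ => Finset.sum_congr rfl fun _ _ => ?_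
      congr 1; field_simp
    · rw [norm_smul, Complex.norm_real, Real.norm_of_nonneg hc0.le]
      gcongr
      exact Real.le_sqrt_of_sq_le hγ
    · rw [mul_assoc, Real.mul_self_sqrt ht]
  have h1 : ∀ c, ‖T‖ < c → ROW F n (x.map T) ≤ c * ROW E n x := fun c hc =>
    ge_of_tendsto (x := nhdsWithin (ROW E n x) (Set.Ioi (ROW E n x))) (f := fun t => c * t)
      (tendsto_nhdsWithin_of_tendsto_nhds (Continuous.tendsto (by fun_prop) _))
      (Filter.eventually_of_mem self_mem_nhdsWithin (key c hc))
  exact ge_of_tendsto (x := nhdsWithin ‖T‖ (Set.Ioi ‖T‖)) (f := fun c => c * ROW E n x)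
      (tendsto_nhdsWithin_of_tendsto_nhds (Continuous.tendsto (by fun_prop) _))
      (Filter.eventually_of_mem self_mem_nhdsWithin h1)

/-! ### Operator spaces and homogeneity -/

/-- A criterion for operator spaces: only one inequality in the direct sum axiom is needed, and
homogeneity and definiteness are automatic. -/
lemma IsOperatorSpace.of_le {M : MatNorms E} (nonneg : ∀ n x, 0 ≤ M n x)
    (triangle : ∀ n x y, M n (x + y) ≤ M n x + M n y)
    (norm_one : ∀ x, M 1 x = ‖x 0 0‖)
    (dirSum_le : ∀ (m n : ℕ) (x : Matrix (Fin m) (Fin m) E) (y : Matrix (Fin n) (Fin n) E),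
      M (m + n) (dirSum x y) ≤ max (M m x) (M n y))
    (norm_mul : ∀ (m n : ℕ) (α : Matrix (Fin n) (Fin m) ℂ) (x : Matrix (Fin m) (Fin m) E)
      (β : Matrix (Fin m) (Fin n) ℂ), M n (rmul (lmul α x) β) ≤ ‖α‖ * M m x * ‖β‖) :
    IsOperatorSpace M := by
  -- Compression by a coordinate isometry is contractive; this is the lower estimate in the direct
  -- sum axiom.
  have compress : ∀ (m n : ℕ) (f : Fin n → Fin m) (_ : Function.Injective f)
      (x : Matrix (Fin m) (Fin m) E), M n (x.submatrix f f) ≤ M m x := by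
    intro m n f hf x
    have e : x.submatrix f f = rmul (lmul ((1 : Matrix (Fin m) (Fin m) ℂ).submatrix f id) x)
        ((1 : Matrix (Fin m) (Fin m) ℂ).submatrix id f) := by
      ext i j
      simp [rmul, lmul, Matrix.one_apply]
    have h1 : ‖(1 : Matrix (Fin m) (Fin m) ℂ).submatrix f id‖ ≤ 1 := by
      refine norm_le_of_mulVec zero_le_one fun ξ => ?_
      simp only [Matrix.submatrix_apply, Matrix.one_apply, id, ite_mul, one_mul, zero_mul,
        Finset.sum_ite_eq, Finset.mem_univ, if_true, one_pow, sqNorm]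
      refine (Finset.sum_map Finset.univ ⟨f, hf⟩ (fun k => ‖ξ k‖ ^ 2)).symm.le.trans ?_
      exact Finset.sum_le_sum_of_subset_of_nonneg (Finset.subset_univ _) fun _ _ _ => sq_nonneg _
    have h2 : ‖(1 : Matrix (Fin m) (Fin m) ℂ).submatrix id f‖ ≤ 1 := by
      refine norm_le_of_vecMul zero_le_one fun ξ => ?_
      simp only [Matrix.submatrix_apply, Matrix.one_apply, id, mul_ite, mul_one, mul_zero,
        Finset.sum_ite_eq', Finset.mem_univ, if_true, one_pow, one_mul, sqNorm]
      refine (Finset.sum_map Finset.univ ⟨f, hf⟩ (fun k => ‖ξ k‖ ^ 2)).symm.le.trans ?_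
      exact Finset.sum_le_sum_of_subset_of_nonneg (Finset.subset_univ _) fun _ _ _ => sq_nonneg _
    rw [e]
    refine (norm_mul _ _ _ _ _).trans ?_
    have := nonneg m x
    calc _ ≤ 1 * M m x * 1 := by gcongr
      _ = _ := by ring
  have smul_le : ∀ n (c : ℂ) (x : Matrix (Fin n) (Fin n) E), M n (c • x) ≤ ‖c‖ * M n x := by
    intro n c x
    have e : c • x = rmul (lmul (c • (1 : Matrix (Fin n) (Fin n) ℂ)) x) 1 := by
      ext i j
      simp [rmul, lmul, Matrix.one_apply]
    rw [e]
    refine (norm_mul _ _ _ _ _).trans ?_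
    have h0 := nonneg n x
    have h1 := norm_one_le_one (κ := Fin n)
    rw [norm_smul]
    calc _ ≤ (‖c‖ * 1) * M n x * 1 := by gcongr
      _ = _ := by ring
  refine ⟨triangle, fun n c x => ?_, fun n x hx => ?_, norm_one, fun m n x y => ?_, norm_mul⟩
  · refine le_antisymm (smul_le n c x) ?_
    rcases eq_or_ne c 0 with rfl | hc
    · simpa using nonneg n _
    · have := smul_le n c⁻¹ (c • x)
      rw [smul_smul, inv_mul_cancel₀ hc, one_smul, norm_inv] at this
      rwa [← le_inv_mul_iff₀ (norm_pos_iff.2 hc)]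
  -- Compression to one entry lands in `M_1(E) = E`, where norm zero forces the entry to vanish.
  · ext i j
    have h1 := norm_mul n 1 (Matrix.of fun _ k => if k = i then 1 else 0) x
      (Matrix.of fun k _ => if k = j then 1 else 0)
    rw [norm_one, hx, mul_zero, zero_mul] at h1
    simpa [rmul, lmul] using h1
  · refine le_antisymm (dirSum_le m n x y) (max_le ?_ ?_)
    · have := compress (m + n) m (fun i => finSumFinEquiv (Sum.inl i))
        (finSumFinEquiv.injective.comp Sum.inl_injective) (dirSum x y)
      refine (le_of_eq ?_).trans this
      congr 1
      ext i j
      simp [dirSum_apply, -finSumFinEquiv_apply_left]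
    · have := compress (m + n) n (fun i => finSumFinEquiv (Sum.inr i))
        (finSumFinEquiv.injective.comp Sum.inr_injective) (dirSum x y)
      refine (le_of_eq ?_).trans this
      congr 1
      ext i j
      simp [dirSum_apply, -finSumFinEquiv_apply_right]

/-- Size one already gives `‖T‖ ≤ ‖T‖_cb`, since `M 1` is the norm of `E`; the same estimate for a
merely linear `T` derives continuity from complete boundedness. -/
lemma IsHomogeneous.of_map_le {M : MatNorms E} (norm_one : ∀ x, M 1 x = ‖x 0 0‖)
    (map_le : ∀ (T : E →L[ℂ] E) (n : ℕ) (x : Matrix (Fin n) (Fin n) E),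
      M n (x.map T) ≤ ‖T‖ * M n x) : IsHomogeneous M := by
  have lower : ∀ (T : E →ₗ[ℂ] E) (x : E), ‖x‖ ≤ 1 → ENNReal.ofReal ‖T x‖ ≤ cbNorm M M T := by
    intro T x hx
    refine le_trans ?_ (le_iSup _ 1)
    have := le_mapNorm (p := M 1) (q := M 1) (T := fun x => x.map T)
      (x := Matrix.of fun _ _ => x) (by rw [norm_one]; exact hx)
    rwa [norm_one] at this
  have upper : ∀ T : E →L[ℂ] E, cbNorm M M (T : E →ₗ[ℂ] E) ≤ ENNReal.ofReal ‖T‖ := fun T =>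
    iSup_le fun n => mapNorm_le fun x hx =>
      (map_le T n x).trans (mul_le_of_le_one_right (norm_nonneg _) hx)
  have bound : ∀ T : E →ₗ[ℂ] E, cbNorm M M T ≠ ∞ → ∀ x, ‖T x‖ ≤ (cbNorm M M T).toReal * ‖x‖ := by
    intro T hT x
    rcases eq_or_ne x 0 with rfl | hx
    · simp
    · have hp : 0 < ‖x‖ := norm_pos_iff.2 hx
      have h1 := (ENNReal.ofReal_le_iff_le_toReal hT).1
        (lower T ((‖x‖⁻¹ : ℂ) • x) (by rw [norm_smul]; simp [hp.ne']))
      rw [map_smul, norm_smul, norm_inv, Complex.norm_real, norm_norm,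
        inv_mul_le_iff₀ hp] at h1
      linarith
  refine ⟨fun T => ⟨fun hT => ?_, fun hT => ?_⟩, fun T => ?_⟩
  · exact (T.mkContinuous _ (bound T hT.ne)).continuous
  · exact (upper ⟨T, hT⟩).trans_lt ENNReal.ofReal_lt_top
  · rw [← ofReal_norm]
    refine le_antisymm (upper T) ?_
    have hfin : cbNorm M M (T : E →ₗ[ℂ] E) ≠ ∞ :=
      ((upper T).trans_lt ENNReal.ofReal_lt_top).ne
    rw [ENNReal.ofReal_le_iff_le_toReal hfin]
    exact T.opNorm_le_bound ENNReal.toReal_nonneg (bound _ hfin)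

lemma isOperatorSpace_COL : IsOperatorSpace (COL E) :=
  .of_le (fun _ => COL_nonneg) (fun _ => COL_add) COL_one (fun _ _ => COL_dirSum_le)
    (fun _ _ => COL_mul_le)

lemma isOperatorSpace_ROW : IsOperatorSpace (ROW E) :=
  .of_le (fun _ => ROW_nonneg) (fun _ => ROW_add) ROW_one (fun _ _ => ROW_dirSum_le)
    (fun _ _ => ROW_mul_le)

lemma isHomogeneous_COL : IsHomogeneous (COL E) :=
  .of_map_le COL_one fun T _ => COL_map_le T

lemma isHomogeneous_ROW : IsHomogeneous (ROW E) :=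
  .of_map_le ROW_one fun T _ => ROW_map_le T

end General

/-! ### The pairing between column and row spaces -/

section Pairing

variable {E F : Type*} [NormedAddCommGroup E] [NormedSpace ℂ E] [NormedAddCommGroup F]
  [NormedSpace ℂ F]

/-- A contractive bilinear form is jointly completely contractive on `COL(E) × ROW(F)`. -/
lemma norm_pairing_le (B : E →L[ℂ] F →L[ℂ] ℂ) (hB : ‖B‖ ≤ 1) {m n : ℕ}
    (x : Matrix (Fin m) (Fin m) E) (y : Matrix (Fin n) (Fin n) F) (ζ η : Fin m × Fin n → ℂ) :
    ‖∑ q, ∑ r, ζ q * B (x q.1 r.1) (y q.2 r.2) * η r‖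
      ≤ COL E m x * ROW F n y * √(sqNorm ζ) * √(sqNorm η) := by
  have key : ∀ t, ROW F n y < t → ‖∑ q, ∑ r, ζ q * B (x q.1 r.1) (y q.2 r.2) * η r‖
      ≤ COL E m x * t * √(sqNorm ζ) * √(sqNorm η) := by
    intro t hyt
    have ht : 0 ≤ t := (ROW_nonneg y).trans hyt.le
    obtain ⟨k, l, α, v, β, hv, hy, hα, hβ⟩ := exists_of_ROW_lt hyt
    -- In the factorization of `y`, the factor `β` is absorbed into `η` and `α` into `ζ`. What
    -- remains for each block `c` is the pairing of `z c = x (ηc c)`, a column over max(E), with `v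
    -- c`, a column over min(F).
    set ηc : Fin k → Fin m → ℂ := fun c b => ∑ j, β c j * η (b, j) with hηc
    set ζc : Fin k → Fin m × Fin l → ℂ := fun c s => ∑ i, ζ (s.1, i) * α i (c, s.2) with hζc
    set z : Fin k → Fin m → E := fun c a => ∑ b, ηc c b • x a b with hz
    have e1 : ∑ q, ∑ r, ζ q * B (x q.1 r.1) (y q.2 r.2) * η r
        = ∑ c, ∑ s : Fin m × Fin l, B (z c s.1) (v c s.2) * ζc c s := by
      have e2 : ∀ q r, ζ q * B (x q.1 r.1) (y q.2 r.2) * η r = ∑ c, ∑ p,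
          ζ q * (β c r.2 * α q.2 (c, p) * B (x q.1 r.1) (v c p)) * η r := by
        intro q r
        simp [hy, Finset.mul_sum, Finset.sum_mul]
      have e3 : ∀ c (s : Fin m × Fin l), B (z c s.1) (v c s.2) * ζc c s = ∑ i, ∑ r,
          ζ (s.1, i) * (β c r.2 * α i (c, s.2) * B (x s.1 r.1) (v c s.2)) * η r := by
        intro c s
        simp only [hz, hζc, hηc, map_sum, map_smul, sum_apply,
          smul_apply, smul_eq_mul, Finset.mul_sum, Finset.sum_mul]
        refine Finset.sum_congr rfl fun i _ => ?_
        rw [Fintype.sum_prod_type]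
        refine Finset.sum_congr rfl fun _ _ => Finset.sum_congr rfl fun _ _ => ?_
        ring
      simp only [e2, e3]
      calc _ = ∑ q : Fin m × Fin n, ∑ c, ∑ p, ∑ r : Fin m × Fin n,
            ζ q * (β c r.2 * α q.2 (c, p) * B (x q.1 r.1) (v c p)) * η r := by
            refine Finset.sum_congr rfl fun q _ => ?_
            rw [Finset.sum_comm]
            exact Finset.sum_congr rfl fun c _ => Finset.sum_comm
        _ = ∑ c, ∑ q : Fin m × Fin n, ∑ p, ∑ r : Fin m × Fin n,
            ζ q * (β c r.2 * α q.2 (c, p) * B (x q.1 r.1) (v c p)) * η r := Finset.sum_comm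
        _ = _ := by
            refine Finset.sum_congr rfl fun c _ => ?_
            rw [Fintype.sum_prod_type, Fintype.sum_prod_type]
            exact Finset.sum_congr rfl fun a _ => Finset.sum_comm
    have h1 : ∀ c, ‖∑ s : Fin m × Fin l, B (z c s.1) (v c s.2) * ζc c s‖
        ≤ COL E m x * (√(sqNorm (ηc c)) * √(sqNorm (ζc c))) := by
      intro c
      refine (norm_sum_mul_le _ _).trans ?_
      rw [← mul_assoc]
      gcongr
      refine (Real.sqrt_le_sqrt (sqNorm_pairing_le B hB (z c) (v c))).trans ?_
      rw [Real.sqrt_sq (mul_nonneg (maxSeq_nonneg _) (minSeq_nonneg _))]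
      exact (mul_le_of_le_one_right (maxSeq_nonneg _) (hv c)).trans (maxSeq_applyVec_le x (ηc c))
    -- Each of `β` and `α` acts on one tensor factor only, so the bounds on their norms carry over;
    -- `h4` is then Cauchy–Schwarz over the blocks.
    have h2 : ∑ c, sqNorm (ηc c) ≤ t * sqNorm η := by
      calc ∑ c, sqNorm (ηc c) = ∑ b, sqNorm (fun c => ∑ j, β c j * η (b, j)) := Finset.sum_comm
        _ ≤ ∑ b, t * sqNorm (fun j => η (b, j)) := by
            gcongr with b
            exact (sqNorm_mulVec_le _ _).trans (mul_le_mul_of_nonneg_right hβ (sqNorm_nonneg _))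
        _ = _ := by rw [← Finset.mul_sum]; simp [sqNorm, Fintype.sum_prod_type]
    have h3 : ∑ c, sqNorm (ζc c) ≤ t * sqNorm ζ := by
      calc ∑ c, sqNorm (ζc c) = ∑ a, sqNorm (fun s => ∑ i, ζ (a, i) * α i s) := by
            simp only [sqNorm, hζc, Fintype.sum_prod_type]
            exact Finset.sum_comm
        _ ≤ ∑ a, t * sqNorm (fun i => ζ (a, i)) := by
            gcongr with a
            exact (sqNorm_vecMul_le _ _).trans (mul_le_mul_of_nonneg_right hα (sqNorm_nonneg _))
        _ = _ := by rw [← Finset.mul_sum]; simp [sqNorm, Fintype.sum_prod_type]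
    have h4 : ∑ c, √(sqNorm (ηc c)) * √(sqNorm (ζc c)) ≤ t * √(sqNorm ζ) * √(sqNorm η) := by
      refine (pow_le_pow_iff_left₀ (by positivity) (by positivity) two_ne_zero).1 ?_
      refine (Finset.sum_mul_sq_le_sq_mul_sq _ _ _).trans ?_
      simp only [Real.sq_sqrt (sqNorm_nonneg _), mul_pow]
      calc _ ≤ (t * sqNorm η) * (t * sqNorm ζ) := by
            gcongr
            · exact Finset.sum_nonneg fun _ _ => sqNorm_nonneg _
            · exact mul_nonneg ht (sqNorm_nonneg _)
        _ = _ := by ring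
    rw [e1]
    refine (norm_sum_le _ _).trans ((Finset.sum_le_sum fun c _ => h1 c).trans ?_)
    rw [← Finset.mul_sum, mul_assoc, mul_assoc, ← mul_assoc t]
    gcongr
    exact COL_nonneg x
  exact ge_of_tendsto (x := nhdsWithin (ROW F n y) (Set.Ioi (ROW F n y)))
    (f := fun t => COL E m x * t * √(sqNorm ζ) * √(sqNorm η))
    (tendsto_nhdsWithin_of_tendsto_nhds (Continuous.tendsto (by fun_prop) _))
    (Filter.eventually_of_mem self_mem_nhdsWithin key)

end Pairing

/-! ### The upper bounds for the dual norms -/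

section Dual

variable {E : Type*} [NormedAddCommGroup E] [NormedSpace ℂ E]

/-- The norm of the `mn × mn` matrix is read off its bilinear form, with rows and columns indexed by
pairs (index in `x`, index in `f`). -/
lemma cbNorm_functionalMatrix_le {M : MatNorms E} {n : ℕ}
    {f : Matrix (Fin n) (Fin n) (StrongDual ℂ E)} {C : ℝ} (hC : 0 ≤ C)
    (h : ∀ (m : ℕ) (x : Matrix (Fin m) (Fin m) E) (ζ η : Fin m × Fin n → ℂ),
      ‖∑ q, ∑ r, ζ q * f q.2 r.2 (x q.1 r.1) * η r‖
        ≤ C * M m x * √(sqNorm ζ) * √(sqNorm η)) :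
    cbNorm M (scalarMat n) (functionalMatrix f) ≤ ENNReal.ofReal C := by
  refine iSup_le fun m => mapNorm_le fun x hx => ?_
  refine norm_le_of_bilin hC fun ζ η => (h m x ζ η).trans ?_
  gcongr
  exact mul_le_of_le_one_right hC hx

/-- The converse reading, extended from the unit ball by scaling. Finiteness matters because `dual`
is a `toReal`; definiteness settles the matrices of norm zero. -/
lemma norm_sum_le_dual {M : MatNorms E} (hM : IsOperatorSpace M) {n : ℕ}
    {f : Matrix (Fin n) (Fin n) (StrongDual ℂ E)}
    (hf : cbNorm M (scalarMat n) (functionalMatrix f) ≠ ∞)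
    (hM0 : ∀ m x, 0 ≤ M m x) {m : ℕ} (x : Matrix (Fin m) (Fin m) E) (ζ η : Fin m × Fin n → ℂ) :
    ‖∑ q, ∑ r, ζ q * f q.2 r.2 (x q.1 r.1) * η r‖
      ≤ dual M n f * M m x * √(sqNorm ζ) * √(sqNorm η) := by
  have key : ∀ x : Matrix (Fin m) (Fin m) E, M m x ≤ 1 →
      ‖∑ q, ∑ r, ζ q * f q.2 r.2 (x q.1 r.1) * η r‖
        ≤ dual M n f * √(sqNorm ζ) * √(sqNorm η) := by
    intro x hx
    have h0 : ENNReal.ofReal (scalarMat n m (x.map (functionalMatrix f)))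
        ≤ cbNorm M (scalarMat n) (functionalMatrix f) :=
      (le_mapNorm (p := M m) (q := scalarMat n m)
        (T := fun x : Matrix (Fin m) (Fin m) E => x.map (functionalMatrix f)) hx).trans
        (le_iSup (fun m => mapNorm (M m) (scalarMat n m)
          (fun x : Matrix (Fin m) (Fin m) E => x.map (functionalMatrix f))) m)
    have h1 : scalarMat n m (x.map (functionalMatrix f)) ≤ dual M n f :=
      (ENNReal.ofReal_le_iff_le_toReal hf).1 h0
    have h2 := norm_bilin_le (Matrix.comp (Fin m) (Fin m) (Fin n) (Fin n) ℂ
      (x.map (functionalMatrix f))) ζ η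
    refine LE.le.trans h2 ?_
    gcongr
    exact h1
  rcases eq_or_ne (M m x) 0 with h0 | h0
  · have := hM.definite m x h0
    rw [h0]
    simp [this]
  · have hp : 0 < M m x := lt_of_le_of_ne (hM0 m x) (Ne.symm h0)
    have hc : ((M m x : ℝ) : ℂ) ≠ 0 := by exact_mod_cast h0
    have h1 := key (((M m x : ℝ) : ℂ)⁻¹ • x) (by
      rw [hM.homog, norm_inv, Complex.norm_real, Real.norm_of_nonneg hp.le, inv_mul_cancel₀ h0])
    have e : ∑ q, ∑ r, ζ q * f q.2 r.2 ((((M m x : ℝ) : ℂ)⁻¹ • x) q.1 r.1) * η r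
        = ((M m x : ℝ) : ℂ)⁻¹ * ∑ q, ∑ r, ζ q * f q.2 r.2 (x q.1 r.1) * η r := by
      simp only [Finset.mul_sum]
      refine Finset.sum_congr rfl fun q _ => Finset.sum_congr rfl fun r _ => ?_
      simp only [Matrix.smul_apply, map_smul, smul_eq_mul]
      ring
    rw [e, norm_mul, norm_inv, Complex.norm_real, Real.norm_of_nonneg hp.le,
      inv_mul_le_iff₀ hp] at h1
    exact h1.trans_eq (by ring)

lemma cbNorm_COL_le (n : ℕ) (f : Matrix (Fin n) (Fin n) (StrongDual ℂ E)) :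
    cbNorm (COL E) (scalarMat n) (functionalMatrix f)
      ≤ ENNReal.ofReal (ROW (StrongDual ℂ E) n f) := by
  refine cbNorm_functionalMatrix_le (ROW_nonneg f) fun m x ζ η => ?_
  rw [mul_comm (ROW _ n f)]
  exact norm_pairing_le (NormedSpace.inclusionInDoubleDual ℂ E)
    (NormedSpace.inclusionInDoubleDual_norm_le ℂ E) x f ζ η

/-- Here `f` is the column factor of the pairing and `x` the row factor, so the two components of
every index pair are swapped. -/
lemma cbNorm_ROW_le (n : ℕ) (f : Matrix (Fin n) (Fin n) (StrongDual ℂ E)) :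
    cbNorm (ROW E) (scalarMat n) (functionalMatrix f)
      ≤ ENNReal.ofReal (COL (StrongDual ℂ E) n f) := by
  refine cbNorm_functionalMatrix_le (COL_nonneg f) fun m x ζ η => ?_
  have h := norm_pairing_le (ContinuousLinearMap.id ℂ (StrongDual ℂ E))
    ContinuousLinearMap.norm_id_le f x (ζ ∘ Prod.swap) (η ∘ Prod.swap)
  have e : ∀ ζ : Fin m × Fin n → ℂ, sqNorm (ζ ∘ Prod.swap) = sqNorm ζ := fun ζ =>
    (Equiv.prodComm _ _).sum_comp (fun q => ‖ζ q‖ ^ 2)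
  rw [e, e] at h
  refine (le_of_eq ?_).trans h
  congr 1
  refine ((Equiv.prodComm _ _).sum_comp _).symm.trans (Finset.sum_congr rfl fun q _ => ?_)
  exact ((Equiv.prodComm _ _).sum_comp _).symm

end Dual

/-! ### Hahn–Banach theorems with lower bounds on a cone -/

section HahnBanach

/-- A sublinear functional `N` dominates a linear functional that is bounded below by prescribed
values `c i` at given points `a i`, provided that `N` dominates the values `∑ t i * c i` at all
conic combinations `∑ t i • a i`. -/
lemma exists_linear_le_of_conic {W I : Type*} [AddCommGroup W] [Module ℝ W] (N : W → ℝ)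
    (N_smul : ∀ t : ℝ, 0 < t → ∀ w, N (t • w) = t * N w)
    (N_add : ∀ w w', N (w + w') ≤ N w + N w') (a : I → W) (c : I → ℝ)
    (h : ∀ (s : Finset I) (t : I → ℝ), (∀ i, 0 ≤ t i) →
      ∑ i ∈ s, t i * c i ≤ N (∑ i ∈ s, t i • a i)) :
    ∃ φ : W →ₗ[ℝ] ℝ, (∀ w, φ w ≤ N w) ∧ ∀ i, c i ≤ φ (a i) := by
  let A := Finsupp.linearCombination ℝ a
  let C := Finsupp.linearCombination ℝ c
  let P := {t : I →₀ ℝ // 0 ≤ t}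
  have hP : Nonempty P := ⟨0, le_rfl⟩
  have hAC : ∀ t : P, C t.1 ≤ N (A t.1) := fun t => h t.1.support t.1 t.2
  -- The lower bounds are absorbed into a sublinear functional, which the conic hypothesis keeps
  -- above `-N (-w)`. If `φ ≤ q`, then `t = 0` gives `φ ≤ N`, and weight one at `i` gives `φ (-a i)
  -- ≤ N 0 - c i`.
  let q : W → ℝ := fun w => ⨅ t : P, (N (w + A t.1) - C t.1)
  have hlow : ∀ w (t : P), -N (-w) ≤ N (w + A t.1) - C t.1 := by
    intro w t
    have h1 := N_add (w + A t.1) (-w)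
    have h2 := hAC t
    rw [add_neg_cancel_comm] at h1
    linarith
  have hbdd : ∀ w, BddBelow (Set.range fun t : P => N (w + A t.1) - C t.1) := fun w =>
    ⟨-N (-w), by rintro _ ⟨t, rfl⟩; exact hlow w t⟩
  have hq_le : ∀ w (t : P), q w ≤ N (w + A t.1) - C t.1 := fun w t => ciInf_le (hbdd w) t
  have q_add : ∀ w w', q (w + w') ≤ q w + q w' := by
    intro w w'
    rw [← sub_le_iff_le_add]
    refine le_ciInf fun t => ?_
    rw [sub_le_comm]
    refine le_ciInf fun t' => ?_
    have h1 := hq_le (w + w') ⟨t.1 + t'.1, add_nonneg t.2 t'.2⟩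
    have h2 := N_add (w + A t.1) (w' + A t'.1)
    simp only [map_add] at h1
    rw [add_add_add_comm] at h2
    linarith
  have q_smul_le : ∀ r : ℝ, 0 < r → ∀ w, q (r • w) ≤ r * q w := by
    intro r hr w
    rw [← div_le_iff₀' hr]
    refine le_ciInf fun t => ?_
    rw [div_le_iff₀' hr]
    have h1 := hq_le (r • w) ⟨r • t.1, smul_nonneg hr.le t.2⟩
    simp only [map_smul] at h1
    rw [← smul_add, N_smul r hr, smul_eq_mul] at h1
    linarith
  have q_smul : ∀ r : ℝ, 0 < r → ∀ w, q (r • w) = r * q w := by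
    intro r hr w
    refine le_antisymm (q_smul_le r hr w) ?_
    have := q_smul_le r⁻¹ (inv_pos.2 hr) (r • w)
    rwa [smul_smul, inv_mul_cancel₀ hr.ne', one_smul, le_inv_mul_iff₀ hr] at this
  have N_zero : N 0 = 0 := by
    have := N_smul 2 two_pos 0
    rw [smul_zero] at this
    linarith
  have q_zero : 0 ≤ q 0 := le_ciInf fun t => by
    rw [zero_add]
    linarith [hAC t]
  obtain ⟨φ, -, hφ⟩ := exists_extension_of_le_sublinear (⊥ : W →ₗ.[ℝ] ℝ) q q_smul q_add (by
    intro x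
    have hx : x = 0 := Subtype.ext ((Submodule.mem_bot ℝ).1 x.2)
    subst hx
    exact (LinearPMap.map_zero _).trans_le q_zero)
  refine ⟨φ, fun w => ?_, fun i => ?_⟩
  · have := (hφ w).trans (hq_le w ⟨0, le_rfl⟩)
    simpa using this
  · have h1 := (hφ (-a i)).trans (hq_le (-a i) ⟨Finsupp.single i 1, by simp⟩)
    simp only [A, C, Finsupp.linearCombination_single, one_smul, neg_add_cancel, N_zero,
      map_neg] at h1
    linarith

/-- A complex linear functional with prescribed real part, dominated by the same seminorm. -/
lemma exists_complex_of_real_le {V : Type*} [AddCommGroup V] [Module ℂ V] [Module ℝ V]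
    [IsScalarTower ℝ ℂ V] (p : V → ℝ) (hp : ∀ (c : ℂ) x, p (c • x) ≤ ‖c‖ * p x) (φ : V →ₗ[ℝ] ℝ)
    (hφ : ∀ x, φ x ≤ p x) :
    ∃ ψ : V →ₗ[ℂ] ℂ, (∀ x, (ψ x).re = φ x) ∧ ∀ x, ‖ψ x‖ ≤ p x := by
  let ψ : V →ₗ[ℂ] ℂ := Module.Dual.extendRCLike (𝕜 := ℂ) φ
  have hre : ∀ x, (ψ x).re = φ x := Module.Dual.re_extendRCLike_apply (𝕜 := ℂ) φ
  have hp0 : ∀ x, 0 ≤ p x := fun x => by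
    have h1 := (hφ x).trans (le_refl _)
    have h2 := (hφ (-x)).trans (by simpa using hp (-1) x)
    rw [map_neg] at h2
    linarith
  refine ⟨ψ, hre, fun x => ?_⟩
  rcases eq_or_ne (ψ x) 0 with h0 | h0
  · rw [h0, norm_zero]; exact hp0 x
  · have hn : (‖ψ x‖ : ℂ) ≠ 0 := by exact_mod_cast (norm_pos_iff.2 h0).ne'
    -- A phase rotates `ψ x` onto the positive axis, where the bound on the real part applies.
    set u : ℂ := star (ψ x) / ‖ψ x‖ with hu
    have hun : ‖u‖ = 1 := by
      rw [hu, norm_div, norm_star, Complex.norm_real, norm_norm, div_self (norm_ne_zero_iff.2 h0)]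
    have h1 : ψ (u • x) = ‖ψ x‖ := by
      rw [map_smul, smul_eq_mul, hu, div_mul_eq_mul_div, div_eq_iff hn]
      exact (Complex.conj_mul' _).trans (sq _)
    have h2 := (hφ (u • x)).trans (hp u x)
    rwa [← hre, h1, Complex.ofReal_re, hun, one_mul] at h2

/-- The Hahn–Banach theorem for a seminorm. -/
lemma exists_functional_of_seminorm {V : Type*} [AddCommGroup V] [Module ℂ V] (p : V → ℝ)
    (p_add : ∀ x y, p (x + y) ≤ p x + p y) (p_smul : ∀ (c : ℂ) x, p (c • x) = ‖c‖ * p x) (x : V) :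
    ∃ ψ : V →ₗ[ℂ] ℂ, (∀ y, ‖ψ y‖ ≤ p y) ∧ p x ≤ (ψ x).re := by
  let _ : Module ℝ V := Module.complexToReal V
  have hr : ∀ t : ℝ, 0 < t → ∀ w, p (t • w) = t * p w := fun t ht w => by
    have := p_smul t w
    rwa [Complex.norm_real, Real.norm_of_nonneg ht.le] at this
  have p0 : p 0 = 0 := by simpa using p_smul 0 0
  obtain ⟨φ, hφ, hx⟩ := exists_linear_le_of_conic p hr p_add (fun _ : Unit => x) (fun _ => p x) (by
    intro s t ht
    rw [← Finset.sum_mul, ← Finset.sum_smul]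
    rcases (Finset.sum_nonneg fun i (_ : i ∈ s) => ht i).eq_or_lt with h0 | h0
    · rw [← h0, zero_mul, zero_smul, p0]
    · rw [hr _ h0])
  obtain ⟨ψ, hψ, hle⟩ := exists_complex_of_real_le p (fun c x => (p_smul c x).le) φ hφ
  exact ⟨ψ, hle, by rw [hψ]; exact hx ()⟩

end HahnBanach

/-! ### Positive functionals on matrices as densities -/

section Density

open scoped ComplexOrder MatrixOrder

variable {ι : Type*} [Fintype ι] [DecidableEq ι]

/-- A real functional on scalar matrices that is positive on the matrices `ξ ξ^*` is dominated
there by `ξ ↦ ‖B ξ‖²` for some invertible matrix `B`. -/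
lemma exists_invertible_of_positive (φ : Matrix ι ι ℂ →ₗ[ℝ] ℝ)
    (hpos : ∀ ξ : ι → ℂ, 0 ≤ φ (Matrix.vecMulVec ξ (star ξ))) {ε : ℝ} (hε : 0 < ε) :
    ∃ B B' : Matrix ι ι ℂ, B * B' = 1 ∧ B' * B = 1 ∧ ∑ i, ∑ j, ‖B i j‖ ^ 2 ≤ φ 1 + ε ∧
      ∀ ξ : ι → ℂ, φ (Matrix.vecMulVec ξ (star ξ)) ≤ sqNorm (fun i => ∑ j, B i j * ξ j) := by
  let ψ : Matrix ι ι ℂ →ₗ[ℂ] ℂ := Module.Dual.extendRCLike (𝕜 := ℂ) φ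
  have hre : ∀ x, (ψ x).re = φ x := Module.Dual.re_extendRCLike_apply (𝕜 := ℂ) φ
  -- The complexified functional is `T ↦ tr (T P)`, so that `ξ* P ξ = ψ (ξ ξ*)`.
  set P : Matrix ι ι ℂ := Matrix.of fun j i => ψ (Matrix.single i j 1) with hP
  have hψ : ∀ T : Matrix ι ι ℂ, ψ T = ∑ i, ∑ j, T i j * P j i := by
    intro T
    conv_lhs => rw [Matrix.matrix_eq_sum_single T]
    simp only [map_sum]
    refine Finset.sum_congr rfl fun i _ => Finset.sum_congr rfl fun j _ => ?_
    have : Matrix.single i j (T i j) = T i j • Matrix.single i j (1 : ℂ) := by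
      rw [Matrix.smul_single, smul_eq_mul, mul_one]
    rw [this, map_smul]; rfl
  set δ : ℝ := ε / (Fintype.card ι + 1) with hδ
  have hδ0 : 0 < δ := by positivity
  -- The Hermitian part of `P` has the quadratic form `φ (ξ ξ*)`. Adding `δ` makes it positive
  -- definite and raises the trace by at most `ε`; then `A = B* B`, and the squared Hilbert–Schmidt
  -- norm of `B` is the trace of `A`.
  set A : Matrix ι ι ℂ := (2⁻¹ : ℂ) • (P + P.conjTranspose) + (δ : ℂ) • 1 with hA
  have hAherm : A.IsHermitian := by
    rw [Matrix.IsHermitian, hA]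
    simp [Matrix.conjTranspose_add, Matrix.conjTranspose_smul, add_comm]
  have hdot : ∀ ξ : ι → ℂ, star ξ ⬝ᵥ ξ = ((sqNorm ξ : ℝ) : ℂ) := fun ξ => by
    simp [dotProduct, sqNorm, Complex.conj_mul']
  have hquad : ∀ ξ : ι → ℂ, star ξ ⬝ᵥ A.mulVec ξ
      = ((φ (Matrix.vecMulVec ξ (star ξ)) + δ * sqNorm ξ : ℝ) : ℂ) := by
    intro ξ
    have h1 : star ξ ⬝ᵥ P.mulVec ξ = ψ (Matrix.vecMulVec ξ (star ξ)) := by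
      rw [hψ, Finset.sum_comm]
      simp only [dotProduct, Matrix.mulVec, Matrix.vecMulVec_apply, Finset.mul_sum]
      refine Finset.sum_congr rfl fun i _ => Finset.sum_congr rfl fun j _ => ?_
      ring
    have h2 : star ξ ⬝ᵥ P.conjTranspose.mulVec ξ = star (ψ (Matrix.vecMulVec ξ (star ξ))) := by
      rw [← h1]
      simp only [dotProduct, Matrix.mulVec, Finset.mul_sum, star_sum]
      rw [Finset.sum_comm]
      refine Finset.sum_congr rfl fun i _ => Finset.sum_congr rfl fun j _ => ?_
      simp only [Matrix.conjTranspose_apply, star_mul', Pi.star_apply, star_star]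
      ring
    rw [hA, Matrix.add_mulVec, Matrix.smul_mulVec, Matrix.smul_mulVec, Matrix.add_mulVec,
      Matrix.one_mulVec, dotProduct_add, dotProduct_smul, dotProduct_smul, dotProduct_add,
      h1, h2, hdot, ← hre]
    have h4 : ψ (Matrix.vecMulVec ξ (star ξ)) + star (ψ (Matrix.vecMulVec ξ (star ξ))) = _ :=
      Complex.add_conj _
    rw [h4]
    simp
  have hsq : ∀ ξ : ι → ℂ, ξ ≠ 0 → 0 < sqNorm ξ := by
    intro ξ hξ
    obtain ⟨i, hi⟩ := Function.ne_iff.1 hξ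
    have hi' : ξ i ≠ 0 := hi
    exact Finset.sum_pos' (fun _ _ => sq_nonneg _) ⟨i, Finset.mem_univ i, by positivity⟩
  have hApd : A.PosDef := Matrix.PosDef.of_dotProduct_mulVec_pos hAherm fun ξ hξ => by
    rw [hquad]
    have := hsq ξ hξ
    have := hpos ξ
    exact_mod_cast (by positivity : 0 < φ (Matrix.vecMulVec ξ (star ξ)) + δ * sqNorm ξ)
  obtain ⟨B, hB⟩ := CStarAlgebra.nonneg_iff_eq_star_mul_self.mp hApd.posSemidef.nonneg
  have hBdet : IsUnit B.det := by
    have h1 := (Matrix.isUnit_iff_isUnit_det _).1 hApd.isUnit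
    rw [hB, Matrix.det_mul] at h1
    exact isUnit_of_mul_isUnit_right h1
  refine ⟨B, B⁻¹, Matrix.mul_nonsing_inv _ hBdet, Matrix.nonsing_inv_mul _ hBdet, ?_, fun ξ => ?_⟩
  · have h1 : ((∑ i, ∑ j, ‖B i j‖ ^ 2 : ℝ) : ℂ) = A.trace := by
      rw [hB, Finset.sum_comm]
      simp [Matrix.trace, Matrix.mul_apply, Matrix.star_apply, Complex.conj_mul']
    have h2 : A.trace.re = φ 1 + δ * Fintype.card ι := by
      have h3 : P.trace = ψ 1 := by
        rw [hψ]
        simp [Matrix.trace, Matrix.one_apply]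
      rw [hA, Matrix.trace_add, Matrix.trace_smul, Matrix.trace_smul, Matrix.trace_add,
        Matrix.trace_conjTranspose, h3, Matrix.trace_one, ← hre]
      have h4 : ψ 1 + star (ψ 1) = _ := Complex.add_conj _
      rw [h4]
      simp
    have h5 := congrArg Complex.re h1
    rw [Complex.ofReal_re, h2] at h5
    rw [h5]
    have : δ * Fintype.card ι ≤ ε := by
      rw [hδ, div_mul_eq_mul_div, div_le_iff₀ (by positivity)]
      nlinarith
    linarith
  · have h1 : star ξ ⬝ᵥ A.mulVec ξ = ((sqNorm (fun i => ∑ j, B i j * ξ j) : ℝ) : ℂ) := by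
      rw [hB, Matrix.star_eq_conjTranspose, ← Matrix.mulVec_mulVec, Matrix.dotProduct_mulVec,
        ← Matrix.star_mulVec]
      exact hdot (B.mulVec ξ)
    rw [hquad] at h1
    have h2 : φ (Matrix.vecMulVec ξ (star ξ)) + δ * sqNorm ξ
        = sqNorm (fun i => ∑ j, B i j * ξ j) := by exact_mod_cast h1
    have := mul_nonneg hδ0.le (sqNorm_nonneg ξ)
    linarith

end Density

/-! ### Pietsch factorization and functionals on max(F) -/

section Pietsch

lemma norm_mul_conjTranspose {ι κ : Type*} [Fintype ι] [Fintype κ] [DecidableEq ι] [DecidableEq κ]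
    (α : Matrix ι κ ℂ) : ‖α * α.conjTranspose‖ = ‖α‖ ^ 2 := by
  have := Matrix.l2_opNorm_conjTranspose_mul_self α.conjTranspose
  rw [Matrix.conjTranspose_conjTranspose, Matrix.l2_opNorm_conjTranspose] at this
  rw [this, sq]

variable {F : Type*} [NormedAddCommGroup F] [NormedSpace ℂ F]

/-- The Pietsch factorization of a `2`-summing column `g`. -/
lemma exists_factorization_of_summing {n : ℕ} (g : Fin n → F) {K ε : ℝ} (hε : 0 < ε)
    (h : ∀ (κ : Type) [Fintype κ] [DecidableEq κ] (α : Matrix (Fin n) κ ℂ),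
      sqNorm (fun k => ∑ i, α i k • g i) ≤ K ^ 2 * ‖α‖ ^ 2) :
    ∃ (c : Matrix (Fin n) (Fin n) ℂ) (v : Fin n → F), (∀ i, g i = ∑ j, c i j • v j) ∧
      ∑ i, ∑ j, ‖c i j‖ ^ 2 ≤ K ^ 2 + ε ∧ minSeq F n v ≤ 1 := by
  obtain ⟨φ, hφ, hg⟩ := exists_linear_le_of_conic
    (fun T : Matrix (Fin n) (Fin n) ℂ => K ^ 2 * ‖T‖)
    (fun t ht T => by simp only [norm_smul, Real.norm_of_nonneg ht.le]; ring)
    (fun T T' => by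
      rw [← mul_add]
      exact mul_le_mul_of_nonneg_left (norm_add_le _ _) (sq_nonneg K))
    (fun ξ : Fin n → ℂ => Matrix.vecMulVec ξ (star ξ))
    (fun ξ => ‖∑ i, ξ i • g i‖ ^ 2) (by
      intro s t ht
      -- The weighted vectors `√(t ξ) ξ` form the columns of one matrix, so that `∑ t ξ ξ*` is `α
      -- α*`, of norm `‖α‖²`, and the summing hypothesis for `α` is the required conic inequality.
      let α : Matrix (Fin n) (Fin s.card) ℂ :=
        Matrix.of fun i k => (√(t (s.equivFin.symm k)) : ℂ) * (s.equivFin.symm k : Fin n → ℂ) i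
      have h1 := h (Fin s.card) α
      have h2 : sqNorm (fun k => ∑ i, α i k • g i)
          = ∑ ξ ∈ s, t ξ * ‖∑ i, ξ i • g i‖ ^ 2 := by
        rw [← Finset.sum_coe_sort, ← s.equivFin.symm.sum_comp]
        refine Finset.sum_congr rfl fun k _ => ?_
        simp only [α, Matrix.of_apply, mul_smul, ← Finset.smul_sum]
        rw [norm_smul, mul_pow, Complex.norm_real, Real.norm_eq_abs, sq_abs, Real.sq_sqrt (ht _)]
      have h3 : ∑ ξ ∈ s, t ξ • Matrix.vecMulVec ξ (star ξ) = α * α.conjTranspose := by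
        ext i j
        rw [← Finset.sum_coe_sort, ← s.equivFin.symm.sum_comp, Matrix.sum_apply, Matrix.mul_apply]
        refine Finset.sum_congr rfl fun k _ => ?_
        have h4 : ((√(t (s.equivFin.symm k)) : ℝ) : ℂ) * ((√(t (s.equivFin.symm k)) : ℝ) : ℂ)
            = ((t (s.equivFin.symm k) : ℝ) : ℂ) := by
          rw [← Complex.ofReal_mul, Real.mul_self_sqrt (ht _)]
        simp only [α, Matrix.smul_apply, Matrix.vecMulVec_apply, Matrix.conjTranspose_apply,
          Matrix.of_apply, Pi.star_apply, star_mul', Complex.real_smul, ← h4, RCLike.star_def,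
          Complex.conj_ofReal]
        ring
      rw [h3, norm_mul_conjTranspose, ← h2]
      exact h1)
  obtain ⟨B, B', hBB, hBB', hHS, hB⟩ := exists_invertible_of_positive φ
    (fun ξ => (sq_nonneg _).trans (hg ξ)) hε
  -- The column `v` is `g` precomposed with `B⁻¹`: its value at `ξ` has norm at most `‖B B' ξ‖ =
  -- ‖ξ‖`.
  refine ⟨B.transpose, fun j => ∑ i, B' i j • g i, fun i => ?_, ?_, ?_⟩
  · have e : ∑ j, B j i • ∑ k, B' k j • g k = ∑ k, (B' * B) k i • g k := by
      simp only [Finset.smul_sum, smul_smul, Matrix.mul_apply, Finset.sum_smul]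
      rw [Finset.sum_comm]
      exact Finset.sum_congr rfl fun k _ => Finset.sum_congr rfl fun j _ => by rw [mul_comm]
    simp only [Matrix.transpose_apply]
    rw [e, hBB']
    simp [Matrix.one_apply]
  · rw [Finset.sum_comm]
    refine hHS.trans ?_
    have h1 := hφ 1
    have h2 : K ^ 2 * ‖(1 : Matrix (Fin n) (Fin n) ℂ)‖ ≤ K ^ 2 * 1 := by
      gcongr; exact norm_one_le_one
    linarith
  · refine minSeq_le zero_le_one fun ξ => ?_
    rw [one_mul]
    refine Real.le_sqrt_of_sq_le ?_
    have e1 : ∑ j, ξ j • ∑ i, B' i j • g i = ∑ i, (∑ j, B' i j * ξ j) • g i := by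
      simp only [Finset.smul_sum, smul_smul, Finset.sum_smul]
      rw [Finset.sum_comm]
      exact Finset.sum_congr rfl fun k _ => Finset.sum_congr rfl fun j _ => by rw [mul_comm]
    have e2 : (fun i => ∑ j, B i j * ∑ k, B' j k * ξ k) = ξ := by
      have : B.mulVec (B'.mulVec ξ) = ξ := by rw [Matrix.mulVec_mulVec, hBB, Matrix.one_mulVec]
      exact this
    rw [e1]
    refine (hg _).trans ((hB _).trans_eq ?_)
    rw [e2]

/-- The `ℓ²` norm of a finite family of functionals is attained by pairing. -/
lemma sqNorm_dual_le {m : Type*} [Fintype m] (h : m → StrongDual ℂ F) {C : ℝ} (hC : 0 ≤ C)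
    (hh : ∀ e : m → F, ‖∑ k, h k (e k)‖ ≤ C * √(sqNorm e)) : sqNorm h ≤ C ^ 2 := by
  -- A functional need not attain its norm, so every norm is approached up to a factor `r < 1`.
  have key : ∀ r : ℝ, r < 1 → 0 ≤ r → r ^ 2 * sqNorm h ≤ C ^ 2 := by
    intro r hr hr0
    have hex : ∀ k, ∃ e : F, ‖e‖ ≤ 1 ∧ r * ‖h k‖ ≤ ‖h k e‖ := by
      intro k
      rcases eq_or_ne (h k) 0 with h0 | h0
      · exact ⟨0, by simp, by simp [h0]⟩
      · have hp := norm_pos_iff.2 h0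
        obtain ⟨e, he, hle⟩ := ContinuousLinearMap.exists_lt_apply_of_lt_opNorm (h k)
          (show r * ‖h k‖ < ‖h k‖ by nlinarith)
        exact ⟨e, he.le, hle.le⟩
    choose e he hle using hex
    have h1 : sqNorm (fun k => h k (e k)) ≤ C ^ 2 := by
      refine sqNorm_le_of_pairing hC fun b => ?_
      have := hh (fun k => b k • e k)
      simp only [map_smul, smul_eq_mul] at this
      refine this.trans ?_
      gcongr
      refine Finset.sum_le_sum fun k _ => ?_
      rw [norm_smul]
      gcongr
      exact mul_le_of_le_one_right (norm_nonneg _) (he k)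
    refine le_trans ?_ h1
    rw [sqNorm, Finset.mul_sum]
    refine Finset.sum_le_sum fun k _ => ?_
    rw [← mul_pow]
    gcongr
    exact hle k
  have hlim : Filter.Tendsto (fun r : ℝ => r ^ 2 * sqNorm h) (nhdsWithin 1 (Set.Iio 1))
      (nhds (1 ^ 2 * sqNorm h)) :=
    tendsto_nhdsWithin_of_tendsto_nhds (Continuous.tendsto (by fun_prop) _)
  rw [one_pow, one_mul] at hlim
  refine le_of_tendsto hlim ?_
  filter_upwards [Ioo_mem_nhdsLT (show (0 : ℝ) < 1 by norm_num)] with r hr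
  exact key r hr.2 hr.1.le

/-- A functional on `max(F)^[n]` factors through a Hilbert–Schmidt matrix and a column over
`min(F^*)`. -/
lemma exists_factorization_of_le_maxSeq {n : ℕ} (φ : (Fin n → F) →ₗ[ℂ] ℂ) {K ε : ℝ} (hK : 0 ≤ K)
    (hε : 0 < ε) (hφ : ∀ x, ‖φ x‖ ≤ K * maxSeq F n x) :
    ∃ (c : Matrix (Fin n) (Fin n) ℂ) (v : Fin n → StrongDual ℂ F),
      (∀ x, φ x = ∑ i, ∑ j, c i j * v j (x i)) ∧
      ∑ i, ∑ j, ‖c i j‖ ^ 2 ≤ K ^ 2 + ε ∧ minSeq (StrongDual ℂ F) n v ≤ 1 := by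
  let g : Fin n → StrongDual ℂ F := fun i =>
    (φ ∘ₗ LinearMap.single ℂ (fun _ => F) i).mkContinuous K fun e => by
      refine (hφ _).trans ?_
      gcongr
      refine (maxSeq_le_sqrt _).trans_eq ?_
      have : sqNorm (LinearMap.single ℂ (fun _ : Fin n => F) i e) = ‖e‖ ^ 2 := by
        rw [sqNorm, Finset.sum_eq_single i] <;> simp +contextual
      rw [this, Real.sqrt_sq (norm_nonneg _)]
  have hg : ∀ x, φ x = ∑ i, g i (x i) := fun x => by
    conv_lhs => rw [← LinearMap.sum_single_apply (fun _ : Fin n => F) x]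
    rw [map_sum]
    rfl
  -- That `g` is 2-summing is checked by duality: pairing its combinations under `α` with a family
  -- `e` gives `φ (α e)`, and `α e` has norm at most `‖α‖ ‖e‖` in max(F).
  obtain ⟨c, v, hc, hHS, hv⟩ := exists_factorization_of_summing g hε (K := K) (by
    intro κ _ _ α
    rw [← mul_pow]
    refine sqNorm_dual_le _ (by positivity) fun e => ?_
    have e1 : ∑ k, (∑ i, α i k • g i) (e k) = φ (fun i => ∑ k, α i k • e k) := by
      rw [hg]
      simp only [sum_apply, smul_apply, map_sum, map_smul]
      exact Finset.sum_comm
    rw [e1, mul_assoc]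
    refine (hφ _).trans ?_
    gcongr
    exact maxSeq_le α e (fun _ => rfl) le_rfl (Real.sqrt_nonneg _)
      (Real.sq_sqrt (sqNorm_nonneg _)).ge)
  refine ⟨c, v, fun x => ?_, hHS, hv⟩
  rw [hg]
  refine Finset.sum_congr rfl fun i _ => ?_
  rw [hc i]
  simp

end Pietsch

/-! ### Finite nets and nuclear representations -/

section Net

/-- Seminorms on a finite-dimensional Hilbert space are controlled, up to a factor `1 + ε`, by their
values on a fixed finite subset of the unit ball. -/
lemma exists_finite_norming_set (n : ℕ) {ε : ℝ} (hε : 0 < ε) :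
    ∃ T : Finset (EuclideanSpace ℂ (Fin n)), (∀ k ∈ T, ‖k‖ ≤ 1) ∧
      ∀ (p : Seminorm ℂ (EuclideanSpace ℂ (Fin n))) (M : ℝ), 0 ≤ M → (∀ k ∈ T, p k ≤ M) →
        ∀ ξ, p ξ ≤ (1 + ε) * M * ‖ξ‖ := by
  -- The mesh satisfies `1 / (1 - δ) = 1 + ε`, so `S ≤ M + S δ` for the supremum `S` over the ball
  -- gives `S ≤ (1 + ε) M`.
  set δ : ℝ := ε / (1 + ε) with hδ
  have hδ0 : 0 < δ := by positivity
  obtain ⟨t, ht, hfin, hcov⟩ :=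
    (isCompact_closedBall (0 : EuclideanSpace ℂ (Fin n)) 1).finite_cover_balls hδ0
  refine ⟨hfin.toFinset, fun k hk => by simpa using ht (hfin.mem_toFinset.1 hk),
    fun p M hM hp ξ => ?_⟩
  have hscale : ∀ C : ℝ, (∀ η, ‖η‖ ≤ 1 → p η ≤ C) → ∀ η, p η ≤ C * ‖η‖ := by
    intro C hC η
    rcases eq_or_ne η 0 with rfl | h0
    · simp
    · have hpos : 0 < ‖η‖ := norm_pos_iff.2 h0
      have h1 := hC ((‖η‖⁻¹ : ℂ) • η) (by rw [norm_smul]; simp [hpos.ne'])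
      rw [map_smul_eq_mul, norm_inv, Complex.norm_real, norm_norm, inv_mul_le_iff₀ hpos] at h1
      linarith
  have hbdd : BddAbove (p '' Metric.closedBall 0 1) := by
    refine ⟨∑ i, p (EuclideanSpace.single i 1), ?_⟩
    rintro _ ⟨η, hη, rfl⟩
    have e : η = ∑ i, η i • EuclideanSpace.single i (1 : ℂ) := by
      ext j; simp [Pi.single_apply]
    have hη' : ‖η‖ ≤ 1 := by simpa using hη
    conv_lhs => rw [e]
    refine (Finset.le_sum_of_subadditive p (map_zero p).le (map_add_le_add p) _ _).trans ?_
    gcongr with i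
    rw [map_smul_eq_mul]
    exact mul_le_of_le_one_left (apply_nonneg _ _) ((PiLp.norm_apply_le η i).trans hη')
  set S := sSup (p '' Metric.closedBall 0 1) with hS
  have hle : ∀ η, ‖η‖ ≤ 1 → p η ≤ S := fun η hη => le_csSup hbdd ⟨η, by simpa using hη, rfl⟩
  have hS0 : 0 ≤ S := (apply_nonneg p 0).trans (hle 0 (by simp))
  have h1 : S ≤ M + S * δ := by
    refine csSup_le ⟨_, 0, by simp, rfl⟩ ?_
    rintro _ ⟨η, hη, rfl⟩
    obtain ⟨k, hk, hkη⟩ := Set.mem_iUnion₂.1 (hcov hη)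
    have h2 : p η ≤ p k + p (η - k) := by
      have := map_add_le_add p k (η - k)
      rwa [add_sub_cancel] at this
    have h3 := hp k (hfin.mem_toFinset.2 hk)
    have h4 := hscale S hle (η - k)
    have h5 : ‖η - k‖ ≤ δ := by rw [← dist_eq_norm]; exact (Metric.mem_ball.1 hkη).le
    have h6 := mul_le_mul_of_nonneg_left h5 hS0
    linarith
  have h2 : S ≤ (1 + ε) * M := by
    have h3 : (1 + ε) * δ = ε := by rw [hδ]; field_simp
    have h4 := mul_le_mul_of_nonneg_left h1 (show 0 ≤ 1 + ε by positivity)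
    have h5 : (1 + ε) * (S * δ) = S * ε := by rw [mul_comm S, ← mul_assoc, h3, mul_comm]
    linarith
  exact (hscale S hle ξ).trans (by gcongr)

/-- The best constant in a bound of a functional by a seminorm. -/
lemma exists_best_bound {Y : Type*} [AddCommGroup Y] [Module ℂ Y] (N : Seminorm ℂ Y)
    (φ : Y →ₗ[ℂ] ℂ) {C : ℝ} (hφ : ∀ y, ‖φ y‖ ≤ C * N y) :
    ∃ D : ℝ, 0 ≤ D ∧ (∀ y, ‖φ y‖ ≤ D * N y) ∧ ∀ δ > 0, ∃ y, N y ≤ 1 ∧ D - δ ≤ (φ y).re := by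
  have hbdd : BddAbove ((fun y => ‖φ y‖) '' {y | N y ≤ 1}) := by
    refine ⟨|C|, ?_⟩
    rintro _ ⟨y, hy, rfl⟩
    refine (hφ y).trans ((mul_le_mul_of_nonneg_right (le_abs_self C) (apply_nonneg N y)).trans ?_)
    exact mul_le_of_le_one_right (abs_nonneg C) hy
  have hne : ((fun y => ‖φ y‖) '' {y | N y ≤ 1}).Nonempty := ⟨_, 0, by simp, rfl⟩
  have hle : ∀ y, N y ≤ 1 → ‖φ y‖ ≤ sSup ((fun y => ‖φ y‖) '' {y | N y ≤ 1}) :=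
    fun y hy => le_csSup hbdd ⟨y, hy, rfl⟩
  set D := sSup ((fun y => ‖φ y‖) '' {y | N y ≤ 1}) with hD
  refine ⟨D, (norm_nonneg _).trans (hle 0 (by simp)), fun y => ?_, fun δ hδ => ?_⟩
  · rcases (apply_nonneg N y).eq_or_lt with h0 | h0
    · have := hφ y
      rw [← h0, mul_zero] at this ⊢
      exact this
    · have h1 := hle (((N y)⁻¹ : ℂ) • y) (by
        rw [map_smul_eq_mul, norm_inv, Complex.norm_real, Real.norm_of_nonneg h0.le,
          inv_mul_cancel₀ h0.ne'])
      rw [map_smul, norm_smul, norm_inv, Complex.norm_real, Real.norm_of_nonneg h0.le,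
        inv_mul_le_iff₀ h0] at h1
      linarith
  · obtain ⟨_, ⟨y, hy, rfl⟩, hlt⟩ := exists_lt_of_lt_csSup hne (sub_lt_self D hδ)
    have hlt' : D - δ < ‖φ y‖ := hlt
    rcases eq_or_ne (φ y) 0 with h0 | h0
    · refine ⟨y, hy, ?_⟩
      rw [h0] at hlt' ⊢
      simpa using hlt'.le
    · have hn : (‖φ y‖ : ℂ) ≠ 0 := by exact_mod_cast (norm_pos_iff.2 h0).ne'
      refine ⟨(star (φ y) / ‖φ y‖ : ℂ) • y, ?_, ?_⟩
      · rw [map_smul_eq_mul, norm_div, norm_star, Complex.norm_real, norm_norm,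
          div_self (norm_ne_zero_iff.2 h0), one_mul]
        exact hy
      · have h1 : φ ((star (φ y) / ‖φ y‖ : ℂ) • y) = ‖φ y‖ := by
          rw [map_smul, smul_eq_mul, div_mul_eq_mul_div, div_eq_iff hn]
          exact (Complex.conj_mul' _).trans (sq _)
        rw [h1, Complex.ofReal_re]
        exact hlt'.le

/-- A bounded functional on the space of operators from a finite-dimensional Hilbert space to a
seminormed space `Y` is, up to `ε`, a convex combination of functionals `v ↦ φ (v ξ)` with `ξ` in
the unit ball and `φ` a bounded functional on `Y`. -/
lemma exists_nuclear_representation {Y : Type*} [AddCommGroup Y] [Module ℂ Y] (N : Seminorm ℂ Y)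
    {n : ℕ} (h : (Fin n → Y) →ₗ[ℂ] ℂ) {K ε : ℝ} (hK : 0 ≤ K) (hε : 0 < ε)
    (hh : ∀ (v : Fin n → Y) (s : ℝ), 0 ≤ s →
      (∀ ξ : Fin n → ℂ, N (∑ j, ξ j • v j) ≤ s * √(sqNorm ξ)) → ‖h v‖ ≤ K * s) :
    ∃ (κ : Type) (_ : Fintype κ) (ξ : κ → Fin n → ℂ) (φ : κ → Y →ₗ[ℂ] ℂ) (C : κ → ℝ),
      (∀ k, 0 ≤ C k) ∧ (∀ k, sqNorm (ξ k) ≤ 1) ∧ (∀ k y, ‖φ k y‖ ≤ C k * N y) ∧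
      ∑ k, C k ≤ K * (1 + ε) ∧ ∀ v, h v = ∑ k, φ k (∑ j, ξ k j • v j) := by
  obtain ⟨T, hT, hnorming⟩ := exists_finite_norming_set n hε
  -- Evaluation on the net embeds the operators into the ℓ^∞ sum of copies of `Y` up to `1 + ε`. The
  -- functional `h` is extended to that sum and split into its coordinates.
  let a : (Fin n → Y) → T → Y := fun v k => ∑ j, k.1 j • v j
  let p : (T → Y) → ℝ := fun w => K * (1 + ε) * ‖fun k => N (w k)‖
  have hKε : 0 ≤ K * (1 + ε) := by positivity
  have p_smul : ∀ (c : ℂ) w, p (c • w) = ‖c‖ * p w := by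
    intro c w
    have : (fun k => N ((c • w) k)) = ‖c‖ • fun k => N (w k) := by
      ext k; simp [map_smul_eq_mul]
    simp only [p, this]
    rw [norm_smul, norm_norm]; ring
  have p_add : ∀ w w', p (w + w') ≤ p w + p w' := by
    intro w w'
    simp only [p, ← mul_add]
    refine mul_le_mul_of_nonneg_left ?_ hKε
    rw [pi_norm_le_iff_of_nonneg (by positivity)]
    intro k
    rw [Real.norm_of_nonneg (apply_nonneg _ _)]
    have h1 := norm_le_pi_norm (fun k => N (w k)) k
    have h2 := norm_le_pi_norm (fun k => N (w' k)) k
    rw [Real.norm_of_nonneg (apply_nonneg _ _)] at h1 h2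
    exact (map_add_le_add N _ _).trans (add_le_add h1 h2)
  have hbound : ∀ v, ‖h v‖ ≤ p (a v) := by
    intro v
    let L : EuclideanSpace ℂ (Fin n) →ₗ[ℂ] Y :=
      { toFun := fun ξ => ∑ j, ξ j • v j
        map_add' := fun ξ η => by simp [add_smul, Finset.sum_add_distrib]
        map_smul' := fun c ξ => by simp [mul_smul, Finset.smul_sum] }
    have h1 := hnorming (N.comp L) ‖fun k => N (a v k)‖ (norm_nonneg _) (fun k hk => by
      have := norm_le_pi_norm (fun k => N (a v k)) ⟨k, hk⟩
      rwa [Real.norm_of_nonneg (apply_nonneg _ _)] at this)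
    refine (hh v ((1 + ε) * ‖fun k => N (a v k)‖) (by positivity) fun ξ => ?_).trans_eq (by
      simp only [p]; ring)
    rw [sqrt_sqNorm]
    exact h1 (WithLp.toLp 2 ξ)
  have a_add : ∀ v v', a (v + v') = a v + a v' := fun v v' => by
    ext k; simp [a, Finset.sum_add_distrib]
  have a_smul : ∀ (c : ℂ) v, a (c • v) = c • a v := fun c v => by
    ext k; simp [a, Finset.smul_sum, smul_comm c]
  let aL : (Fin n → Y) →ₗ[ℂ] T → Y := { toFun := a, map_add' := a_add, map_smul' := a_smul }
  obtain ⟨φ, hφ, hφa⟩ := exists_linear_le_of_conic p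
    (fun t ht w => by
      have := p_smul t w
      rwa [Complex.norm_real, Real.norm_of_nonneg ht.le, Complex.coe_smul] at this)
    p_add a (fun v => (h v).re) (by
      intro s t ht
      have e1 : ∑ v ∈ s, t v • a v = a (∑ v ∈ s, t v • v) := by
        change _ = (aL.restrictScalars ℝ) _
        rw [map_sum]
        simp only [map_smul]
        rfl
      have e2 : ∑ v ∈ s, t v * (h v).re = (h (∑ v ∈ s, t v • v)).re := by
        change _ = ((h.restrictScalars ℝ) _).re
        rw [map_sum, Complex.re_sum]
        simp only [map_smul]
        simp
      rw [e1, e2]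
      exact (Complex.re_le_norm _).trans (hbound _))
  obtain ⟨ψ, hψ, hψp⟩ := exists_complex_of_real_le p (fun c w => (p_smul c w).le) φ hφ
  -- The conic lemma gives one inequality only; applied also to `-v` it becomes an equality, and `I
  -- • v` then settles the imaginary part.
  have hre : ∀ v, (ψ (a v)).re = (h v).re := by
    intro v
    refine le_antisymm ?_ ((hφa v).trans_eq (hψ _).symm)
    have h1 := (hφa (-v)).trans_eq (hψ _).symm
    have h2 : a (-v) = - a v := map_neg aL v
    rw [h2, map_neg, map_neg, Complex.neg_re, Complex.neg_re] at h1
    linarith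
  have heq : ∀ v, h v = ψ (a v) := by
    intro v
    refine Complex.ext (hre v).symm ?_
    have h1 := hre (Complex.I • v)
    rw [a_smul, map_smul, map_smul, smul_eq_mul, smul_eq_mul, Complex.I_mul_re,
      Complex.I_mul_re] at h1
    linarith
  classical
  have hsingle : ∀ (k : T) (y : Y), ‖(ψ ∘ₗ LinearMap.single ℂ (fun _ : T => Y) k) y‖
      ≤ K * (1 + ε) * N y := by
    intro k y
    refine (hψp _).trans (mul_le_mul_of_nonneg_left ?_ hKε)
    rw [pi_norm_le_iff_of_nonneg (apply_nonneg _ _)]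
    intro l
    rw [Real.norm_of_nonneg (apply_nonneg _ _)]
    rcases eq_or_ne l k with rfl | hl
    · simp
    · simp [hl]
  choose D hD0 hD hDy using fun k => exists_best_bound N _ (hsingle k)
  refine ⟨T, inferInstance, fun k => k.1.ofLp,
    fun k => ψ ∘ₗ LinearMap.single ℂ (fun _ : T => Y) k, D, hD0, fun k => ?_, hD, ?_, fun v => ?_⟩
  · rw [sqNorm_eq_norm_sq]
    exact pow_le_one₀ (norm_nonneg _) (hT k.1 k.2)
  -- Near-optimal `y k` for the separate coordinates form a single point in the unit ball of the ℓ^∞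
  -- sum, at which `φ` nearly equals the sum of the constants.
  · refine le_of_forall_pos_le_add fun η hη => ?_
    have hδ : 0 < η / (Fintype.card T + 1) := by positivity
    choose y hy hyD using fun k => hDy k _ hδ
    have h1 : ∑ k, (ψ (LinearMap.single ℂ (fun _ : T => Y) k (y k))).re = φ y := by
      have e : ∑ k, LinearMap.single ℂ (fun _ : T => Y) k (y k) = y :=
        LinearMap.sum_single_apply (fun _ : T => Y) y
      rw [← hψ, ← Complex.re_sum, ← map_sum, e]
    have h2 : φ y ≤ K * (1 + ε) := by
      refine (hφ y).trans (mul_le_of_le_one_right hKε ?_)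
      rw [pi_norm_le_iff_of_nonneg zero_le_one]
      intro k
      rw [Real.norm_of_nonneg (apply_nonneg _ _)]
      exact hy k
    have h3 : ∑ k, (D k - η / (Fintype.card T + 1)) ≤ φ y := by
      rw [← h1]
      exact Finset.sum_le_sum fun k _ => hyD k
    rw [Finset.sum_sub_distrib, Finset.sum_const, Finset.card_univ, nsmul_eq_mul] at h3
    have h4 : (Fintype.card T : ℝ) * (η / (Fintype.card T + 1)) ≤ η := by
      rw [mul_div_assoc', div_le_iff₀ (by positivity)]
      nlinarith
    linarith
  · rw [heq]
    conv_lhs => rw [← LinearMap.sum_single_apply (fun _ : T => Y) (a v)]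
    rw [map_sum]
    rfl

end Net

/-! ### Functionals on the row space -/

section TwoSided

variable {F : Type*} [NormedAddCommGroup F] [NormedSpace ℂ F]

/-- The matrix `y β` for a column `y` over a vector space and a row `β` of scalars. -/
def colRow {V : Type*} [AddCommGroup V] [Module ℂ V] {n : ℕ} (y : Fin n → V) (β : Fin n → ℂ) :
    Matrix (Fin n) (Fin n) V :=
  Matrix.of fun i j => β j • y i

lemma norm_transpose_le {ι κ : Type*} [Fintype ι] [Fintype κ] [DecidableEq ι] [DecidableEq κ]
    (α : Matrix ι κ ℂ) : ‖α.transpose‖ ≤ ‖α‖ :=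
  norm_le_of_mulVec (norm_nonneg _) fun ξ => by
    simpa only [Matrix.transpose_apply, mul_comm] using sqNorm_vecMul_le α ξ

lemma sqrt_mul_sqrt_complex {t : ℝ} (ht : 0 ≤ t) : (√t : ℂ) * (√t : ℂ) = (t : ℂ) := by
  rw [← Complex.ofReal_mul, Real.mul_self_sqrt ht]

/-- The Pietsch factorization of a contractive functional on `ROW(F)`, with a density on either
side. -/
lemma exists_two_sided_domination {n : ℕ} (Φ : Matrix (Fin n) (Fin n) F →ₗ[ℂ] ℂ)
    (hΦ : ∀ y, ‖Φ y‖ ≤ ROW F n y) :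
    ∃ φ₁ φ₂ : Matrix (Fin n) (Fin n) ℂ →ₗ[ℝ] ℝ, φ₁ 1 ≤ 1 ∧ φ₂ 1 ≤ 1 ∧
      (∀ ξ : Fin n → ℂ, 0 ≤ φ₁ (Matrix.vecMulVec ξ (star ξ))) ∧
      (∀ ξ : Fin n → ℂ, 0 ≤ φ₂ (Matrix.vecMulVec ξ (star ξ))) ∧
      ∀ (α : Matrix (Fin n) (Fin n) ℂ) (v : Fin n → F) (β : Fin n → ℂ), minSeq F n v ≤ 1 →
        2 * (Φ (colRow (colMul α v) β)).re
          ≤ φ₁ (α * α.conjTranspose) + φ₂ (Matrix.vecMulVec β (star β)) := by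
  obtain ⟨φ, hφ, hle⟩ := exists_linear_le_of_conic
    (fun S : Matrix (Fin n) (Fin n) ℂ × Matrix (Fin n) (Fin n) ℂ => ‖S.1‖ + ‖S.2‖)
    (fun t ht S => by
      simp only [Prod.smul_fst, Prod.smul_snd, norm_smul, Real.norm_of_nonneg ht.le]; ring)
    (fun S S' => by
      have h1 := norm_add_le S.1 S'.1
      have h2 := norm_add_le S.2 S'.2
      simp only [Prod.fst_add, Prod.snd_add]
      linarith)
    (fun i : Matrix (Fin n) (Fin n) ℂ × {v : Fin n → F // minSeq F n v ≤ 1} × (Fin n → ℂ) =>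
      (i.1 * i.1.conjTranspose, Matrix.vecMulVec i.2.2 (star i.2.2)))
    (fun i => 2 * (Φ (colRow (colMul i.1 i.2.1.1) i.2.2)).re) (by
      classical
      intro s t ht
      -- Splitting each weight as `√t · √t` makes the conic combination a single product `α diag(v)
      -- γᵀ`, of row norm at most `‖α‖ ‖γ‖`; the estimate closes with `2 ‖α‖ ‖γ‖ ≤ ‖α‖² + ‖γ‖²`.
      let α : Matrix (Fin n) (s × Fin n) ℂ := Matrix.of fun i q => (√(t q.1) : ℂ) * q.1.1.1 i q.2
      let γ : Matrix (Fin n) s ℂ := Matrix.of fun j k => (√(t k) : ℂ) * k.1.2.2 j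
      let x : Matrix (Fin n) (Fin n) F := ∑ k ∈ s, t k • colRow (colMul k.1 k.2.1.1) k.2.2
      have hx : ROW F n x ≤ ‖α‖ * ‖γ‖ := by
        refine ROW_le α (fun k p => k.1.2.1.1 p) γ.transpose
          (fun k => norm_sum_smul_le_of_minSeq_le_one k.1.2.1.2) (fun i j => ?_) le_rfl
          (norm_transpose_le γ)
        change (∑ k ∈ s, t k • colRow (colMul k.1 k.2.1.1) k.2.2) i j = _
        rw [Matrix.sum_apply, ← Finset.sum_coe_sort]
        refine Finset.sum_congr rfl fun k _ => ?_
        simp only [α, γ, colRow, colMul, Matrix.smul_apply, Matrix.of_apply, Finset.smul_sum,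
          Matrix.transpose_apply]
        refine Finset.sum_congr rfl fun p _ => ?_
        rw [← Complex.coe_smul, ← sqrt_mul_sqrt_complex (ht k), smul_smul, smul_smul]
        congr 1; ring
      have h1 : ∑ k ∈ s, t k * (2 * (Φ (colRow (colMul k.1 k.2.1.1) k.2.2)).re)
          = 2 * (Φ x).re := by
        change _ = 2 * ((Φ.restrictScalars ℝ) x).re
        rw [map_sum, Complex.re_sum, Finset.mul_sum]
        refine Finset.sum_congr rfl fun k _ => ?_
        rw [map_smul, Complex.smul_re, smul_eq_mul]
        change _ = 2 * (t k * (Φ _).re)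
        ring
      have h2 : (∑ k ∈ s, t k • (k.1 * k.1.conjTranspose, Matrix.vecMulVec k.2.2 (star k.2.2)) :
          Matrix (Fin n) (Fin n) ℂ × Matrix (Fin n) (Fin n) ℂ)
          = (α * α.conjTranspose, γ * γ.conjTranspose) := by
        refine Prod.ext ?_ ?_
        · rw [Prod.fst_sum]
          ext i j
          change _ = (α * α.conjTranspose) i j
          rw [Matrix.sum_apply, ← Finset.sum_coe_sort, Matrix.mul_apply, Fintype.sum_prod_type]
          refine Finset.sum_congr rfl fun k _ => ?_
          simp only [α, Prod.smul_fst, Matrix.smul_apply, Matrix.mul_apply,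
            Matrix.conjTranspose_apply, Matrix.of_apply, star_mul', RCLike.star_def,
            Complex.conj_ofReal, Complex.real_smul, Finset.mul_sum]
          refine Finset.sum_congr rfl fun p _ => ?_
          rw [← sqrt_mul_sqrt_complex (ht k)]
          ring
        · rw [Prod.snd_sum]
          ext i j
          change _ = (γ * γ.conjTranspose) i j
          rw [Matrix.sum_apply, ← Finset.sum_coe_sort, Matrix.mul_apply]
          refine Finset.sum_congr rfl fun k _ => ?_
          simp only [γ, Prod.smul_snd, Matrix.smul_apply, Matrix.vecMulVec_apply, Pi.star_apply,
            Matrix.conjTranspose_apply, Matrix.of_apply, star_mul', RCLike.star_def,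
            Complex.conj_ofReal, Complex.real_smul]
          rw [← sqrt_mul_sqrt_complex (ht k)]
          ring
      rw [h1, h2]
      simp only [norm_mul_conjTranspose]
      have h3 := (Complex.re_le_norm _).trans ((hΦ x).trans hx)
      nlinarith [sq_nonneg (‖α‖ - ‖γ‖)])
  have hsplit : ∀ S T, φ (S, T) = φ (S, 0) + φ (0, T) := fun S T => by
    rw [← map_add]; simp
  refine ⟨φ ∘ₗ LinearMap.inl ℝ _ _, φ ∘ₗ LinearMap.inr ℝ _ _, ?_, ?_, fun ξ => ?_, fun ξ => ?_,
    fun α v β hv => ?_⟩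
  · refine (hφ _).trans ?_
    simpa using norm_one_le_one (κ := Fin n)
  · refine (hφ _).trans ?_
    simpa using norm_one_le_one (κ := Fin n)
  · have h0 : minSeq F n 0 ≤ 1 := minSeq_le zero_le_one fun ξ => by
      simp
    -- The left factor is a square matrix, so `ξ ξ*` itself is inserted; its `α α*` is `‖ξ‖² ξ ξ*`.
    have h1 := hle (Matrix.vecMulVec ξ (star ξ), ⟨0, h0⟩, 0)
    have h2 : Matrix.vecMulVec ξ (star ξ) * (Matrix.vecMulVec ξ (star ξ)).conjTranspose
        = sqNorm ξ • Matrix.vecMulVec ξ (star ξ) := by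
      ext i j
      simp only [Matrix.mul_apply, Matrix.vecMulVec_apply, Matrix.conjTranspose_apply,
        Pi.star_apply, star_mul', star_star, Matrix.smul_apply, Complex.real_smul]
      have : ((sqNorm ξ : ℝ) : ℂ) = ∑ k, star (ξ k) * ξ k := by
        simp [sqNorm, Complex.conj_mul']
      rw [this, Finset.sum_mul]
      exact Finset.sum_congr rfl fun k _ => by ring
    have h3 : colRow (colMul (Matrix.vecMulVec ξ (star ξ)) (0 : Fin n → F)) (0 : Fin n → ℂ) = 0 := by
      ext; simp [colRow]
    have h4 : Matrix.vecMulVec (0 : Fin n → ℂ) (star (0 : Fin n → ℂ)) = 0 := by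
      ext; simp [Matrix.vecMulVec_apply]
    simp only [h2, h3, h4, map_zero, Complex.zero_re, mul_zero] at h1
    have h5 : φ (sqNorm ξ • Matrix.vecMulVec ξ (star ξ), 0)
        = sqNorm ξ * φ (Matrix.vecMulVec ξ (star ξ), 0) := by
      rw [← smul_eq_mul, ← map_smul]; simp
    rw [h5] at h1
    rcases (sqNorm_nonneg ξ).eq_or_lt with h6 | h6
    · have h7 : ξ = 0 := by
        ext i
        have := (Finset.sum_eq_zero_iff_of_nonneg (fun i _ => sq_nonneg ‖ξ i‖)).1 h6.symm i
          (Finset.mem_univ i)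
        simpa using this
      rw [h7, h4, map_zero]
    · exact nonneg_of_mul_nonneg_right h1 h6
  · have h0 : minSeq F n 0 ≤ 1 := minSeq_le zero_le_one fun ξ => by
      simp
    have h1 := hle (0, ⟨0, h0⟩, ξ)
    have h3 : colRow (colMul (0 : Matrix (Fin n) (Fin n) ℂ) (0 : Fin n → F)) ξ = 0 := by
      ext; simp [colRow, colMul]
    simp only [h3, map_zero, Complex.zero_re, mul_zero, zero_mul] at h1
    exact h1
  · have := hle (α, ⟨v, hv⟩, β)
    rwa [hsplit] at this

/-- The preceding factorization with the densities replaced by invertible matrices. -/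
lemma exists_two_sided_factorization {n : ℕ} (Φ : Matrix (Fin n) (Fin n) F →ₗ[ℂ] ℂ)
    (hΦ : ∀ y, ‖Φ y‖ ≤ ROW F n y) {ε : ℝ} (hε : 0 < ε) :
    ∃ r r' s s' : Matrix (Fin n) (Fin n) ℂ, r' * r = 1 ∧ s' * s = 1 ∧
      ∑ i, ∑ j, ‖r i j‖ ^ 2 ≤ 1 + ε ∧ ∑ i, ∑ j, ‖s i j‖ ^ 2 ≤ 1 + ε ∧
      ∀ (c : Matrix (Fin n) (Fin n) ℂ) (v : Fin n → F) (β : Fin n → ℂ) (t : ℝ), 0 < t →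
        minSeq F n v ≤ 1 → ∑ i, ∑ j, ‖c i j‖ ^ 2 ≤ t ^ 2 → sqNorm β ≤ 1 →
        (Φ (colRow (colMul (r' * c) v) (s'.mulVec β))).re ≤ t := by
  obtain ⟨φ₁, φ₂, h₁, h₂, hpos₁, hpos₂, hle⟩ := exists_two_sided_domination Φ hΦ
  obtain ⟨r, r', hr, hr', hrHS, hrle⟩ := exists_invertible_of_positive φ₁ hpos₁ hε
  obtain ⟨s, s', hs, hs', hsHS, hsle⟩ := exists_invertible_of_positive φ₂ hpos₂ hε
  refine ⟨r, r', s, s', hr', hs', by linarith, by linarith, fun c v β t ht hv hc hβ => ?_⟩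
  have hα : ∀ α : Matrix (Fin n) (Fin n) ℂ,
      φ₁ (α * α.conjTranspose) ≤ ∑ i, ∑ j, ‖(r * α) i j‖ ^ 2 := by
    intro α
    have e : α * α.conjTranspose
        = ∑ p, Matrix.vecMulVec (fun i => α i p) (star fun i => α i p) := by
      ext i j
      simp [Matrix.sum_apply, Matrix.mul_apply, Matrix.vecMulVec_apply]
    rw [e, map_sum, Finset.sum_comm]
    exact Finset.sum_le_sum fun p _ => hrle _
  have ht' : ((√t : ℝ) : ℂ) ≠ 0 := by exact_mod_cast (Real.sqrt_pos.2 ht).ne'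
  -- The scalars `1/√t` and `√t` cancel under `Φ` and balance the two densities, each of which then
  -- contributes at most `t`.
  have h := hle (((√t : ℝ) : ℂ)⁻¹ • (r' * c)) v (((√t : ℝ) : ℂ) • s'.mulVec β) hv
  have e1 : colRow (colMul (((√t : ℝ) : ℂ)⁻¹ • (r' * c)) v) (((√t : ℝ) : ℂ) • s'.mulVec β)
      = colRow (colMul (r' * c) v) (s'.mulVec β) := by
    ext i j
    simp only [colRow, colMul, Matrix.of_apply, Matrix.smul_apply, Pi.smul_apply, Finset.smul_sum,
      smul_smul, smul_eq_mul]
    refine Finset.sum_congr rfl fun p _ => ?_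
    congr 1
    field_simp
  have e2 : r * (((√t : ℝ) : ℂ)⁻¹ • (r' * c)) = ((√t : ℝ) : ℂ)⁻¹ • c := by
    rw [Matrix.mul_smul, ← Matrix.mul_assoc, hr, Matrix.one_mul]
  have h3 := hα (((√t : ℝ) : ℂ)⁻¹ • (r' * c))
  have h4 := hsle (((√t : ℝ) : ℂ) • s'.mulVec β)
  have e3 : (fun i => ∑ j, s i j * (((√t : ℝ) : ℂ) • s'.mulVec β) j) = ((√t : ℝ) : ℂ) • β := by
    have : s.mulVec (((√t : ℝ) : ℂ) • s'.mulVec β) = ((√t : ℝ) : ℂ) • β := by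
      rw [Matrix.mulVec_smul, Matrix.mulVec_mulVec, hs, Matrix.one_mulVec]
    exact this
  rw [e3, sqNorm_smul, Complex.norm_real, Real.norm_eq_abs, sq_abs, Real.sq_sqrt ht.le] at h4
  rw [e2] at h3
  simp only [Matrix.smul_apply, smul_eq_mul, norm_mul, norm_inv, Complex.norm_real,
    Real.norm_eq_abs, mul_pow, inv_pow, sq_abs, Real.sq_sqrt ht.le, ← Finset.mul_sum] at h3
  rw [e1] at h
  have h5 : t⁻¹ * ∑ i, ∑ j, ‖c i j‖ ^ 2 ≤ t := by
    rw [inv_mul_le_iff₀ ht, ← sq]; exact hc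
  have h6 : t * sqNorm β ≤ t := mul_le_of_le_one_right ht.le hβ
  linarith

end TwoSided

/-! ### Rearrangement of finite sums -/

section Algebra

variable {V : Type*} [AddCommGroup V] [Module ℂ V] {ι : Type*} [Fintype ι]

lemma sum_smul_mul {κ : Type*} [Fintype κ] (a : Matrix ι ι ℂ) (c : Matrix ι κ ℂ) (w : κ → V)
    (i : ι) : ∑ p, (a * c) i p • w p = ∑ l, a i l • ∑ p, c l p • w p := by
  simp only [Matrix.mul_apply, Finset.sum_smul, Finset.smul_sum, smul_smul]
  exact Finset.sum_comm

/-- In matrix form, `r' (r f sᵀ) s'ᵀ = f`. -/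
lemma sum_smul_of_mul_eq_one [DecidableEq ι] {r r' s s' : Matrix ι ι ℂ} (hr : r' * r = 1) (hs : s' * s = 1)
    (f : Matrix ι ι V) (i j : ι) :
    ∑ l, ∑ m, (r' i l * s' j m) • ∑ a, ∑ b, (r l a * s m b) • f a b = f i j := by
  have h1 : ∀ (w : ι → V) (i : ι), ∑ p, (1 : Matrix ι ι ℂ) i p • w p = w i := fun w i => by
    simp [Matrix.one_apply]
  have h2 : ∀ l m, ∑ a, ∑ b, (r l a * s m b) • f a b = ∑ b, s m b • ∑ a, r l a • f a b := by
    intro l m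
    simp only [Finset.smul_sum, smul_smul, mul_comm (s m _)]
    exact Finset.sum_comm
  have h3 : ∀ l (w : ι → V), ∑ m, (r' i l * s' j m) • ∑ b, s m b • w b = r' i l • w j := by
    intro l w
    simp only [mul_smul]
    rw [← Finset.smul_sum, ← sum_smul_mul, hs, h1]
  simp only [h2, h3]
  rw [← sum_smul_mul, hr, h1]

/-- In matrix form, multiplication by `r` and `sᵀ` turns `(c v) ξᵀ` into `(r c v) (s ξ)ᵀ`. -/
lemma sum_smul_eq_sum_colRow {n : ℕ} {κ : Type*} [Fintype κ] (r s : Matrix (Fin n) (Fin n) ℂ)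
    (ξ : κ → Fin n → ℂ) (c : κ → Matrix (Fin n) (Fin n) ℂ) (v : κ → Fin n → V) (i j : Fin n) :
    ∑ l, ∑ m, (r i l * s j m) • ∑ k, ξ k m • ∑ p, c k l p • v k p
      = ∑ k, colRow (colMul (r * c k) (v k)) (s.mulVec (ξ k)) i j := by
  simp only [colRow, colMul, Matrix.of_apply, sum_smul_mul, Matrix.mulVec, dotProduct]
  calc _ = ∑ l, ∑ k, ∑ m, (r i l * s j m) • ξ k m • ∑ p, c k l p • v k p := by
        refine Finset.sum_congr rfl fun _ _ => ?_
        rw [Finset.sum_comm]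
        exact Finset.sum_congr rfl fun _ _ => Finset.smul_sum
    _ = ∑ k, ∑ l, ∑ m, (r i l * s j m) • ξ k m • ∑ p, c k l p • v k p := Finset.sum_comm
    _ = _ := by
        refine Finset.sum_congr rfl fun k _ => ?_
        rw [Finset.sum_smul, Finset.sum_comm]
        refine Finset.sum_congr rfl fun m _ => ?_
        rw [Finset.smul_sum]
        refine Finset.sum_congr rfl fun l _ => ?_
        rw [smul_smul, smul_smul]
        congr 1; ring

end Algebra

/-! ### The reverse inequalities for the dual norms -/

section DualNorms

variable {E : Type*} [NormedAddCommGroup E] [NormedSpace ℂ E]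

lemma maxSeq_smul {n : ℕ} (c : ℂ) (x : Fin n → E) : maxSeq E n (c • x) = ‖c‖ * maxSeq E n x :=
  map_smul_eq_mul (maxSeminorm E n) c x

lemma sqNorm_prod {ι κ : Type*} [Fintype ι] [Fintype κ] (c : ι → κ → ℂ) :
    sqNorm (fun q : ι × κ => c q.1 q.2) = ∑ i, ∑ j, ‖c i j‖ ^ 2 := by
  rw [sqNorm, Fintype.sum_prod_type]

/-- The norm of a column over `max(E^*)` is its norm as a functional of Hilbert–Schmidt multiples of
columns over `min(E)`. -/
lemma maxSeq_dual_le {n : ℕ} (g : Fin n → StrongDual ℂ E) {K : ℝ} (hK : 0 ≤ K)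
    (h : ∀ (c : Matrix (Fin n) (Fin n) ℂ) (v : Fin n → E),
      ‖∑ i, ∑ j, c i j * g i (v j)‖ ≤ K * √(∑ i, ∑ j, ‖c i j‖ ^ 2) * minSeq E n v) :
    maxSeq (StrongDual ℂ E) n g ≤ K := by
  obtain ⟨ψ, hψ, hg⟩ := exists_functional_of_seminorm (maxSeq (StrongDual ℂ E) n) maxSeq_add
    maxSeq_smul g
  refine hg.trans ?_
  have key : ∀ ε : ℝ, 0 < ε → (ψ g).re ≤ K * √(1 + ε) * (1 + ε) := by
    intro ε hε
    obtain ⟨c, w, hw, hc, hw1⟩ := exists_factorization_of_le_maxSeq ψ zero_le_one hε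
      (fun x => by rw [one_mul]; exact hψ x)
    rw [one_pow] at hc
    -- The matrix `c` of the norming functional, combined with `g`, gives a functional on B(ℓ²_n,
    -- E), which the hypothesis bounds.
    let hfun : (Fin n → E) →ₗ[ℂ] ℂ :=
      ∑ i, ∑ j, c i j • ((g i : E →ₗ[ℂ] ℂ) ∘ₗ LinearMap.proj j)
    have hfun_apply : ∀ v, hfun v = ∑ i, ∑ j, c i j * g i (v j) := fun v => by
      simp [hfun, LinearMap.sum_apply]
    obtain ⟨κ, _, ξ, φ, C, hC0, hξ, hφ, hCsum, hrep⟩ := exists_nuclear_representation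
      (normSeminorm ℂ E) hfun (K := K * √(1 + ε)) (by positivity) hε (by
        intro v s hs hv
        rw [hfun_apply]
        refine (h c v).trans ?_
        have h1 : minSeq E n v ≤ s := minSeq_le hs hv
        have h2 := minSeq_nonneg v
        gcongr)
    let φ' : κ → StrongDual ℂ E := fun k => (φ k).mkContinuous (C k) (hφ k)
    have hφ' : ∀ k, ‖φ' k‖ ≤ C k := fun k => LinearMap.mkContinuous_norm_le _ (hC0 k) _
    -- Comparing coefficients gives an identity between elements of the dual of `E`, to which the
    -- bidual elements `w j` can be applied.
    have hcg : ∀ j, ∑ i, c i j • g i = ∑ k, ξ k j • φ' k := by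
      intro j
      ext e
      have h1 := hrep (Pi.single j e)
      rw [hfun_apply] at h1
      have h2 : ∀ i, ∑ l, c i l * g i (Pi.single (M := fun _ => E) j e l) = c i j * g i e := by
        intro i
        rw [Finset.sum_eq_single j] <;> simp +contextual
      have h3 : ∀ k, ∑ l, ξ k l • Pi.single (M := fun _ => E) j e l = ξ k j • e := by
        intro k
        rw [Finset.sum_eq_single j] <;> simp +contextual
      simp only [h2, h3, map_smul, smul_eq_mul] at h1
      simp only [sum_apply, smul_apply, smul_eq_mul]
      exact h1
    have h1 : ψ g = ∑ k, (∑ j, ξ k j • w j) (φ' k) := by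
      rw [hw, Finset.sum_comm]
      have h2 : ∀ j, ∑ i, c i j * w j (g i) = ∑ k, ξ k j * w j (φ' k) := by
        intro j
        have := congrArg (w j) (hcg j)
        simpa only [map_sum, map_smul, smul_eq_mul] using this
      simp only [h2, sum_apply, smul_apply, smul_eq_mul]
      exact Finset.sum_comm
    rw [h1]
    refine (Complex.re_le_norm _).trans ((norm_sum_le _ _).trans (le_trans ?_ hCsum))
    refine Finset.sum_le_sum fun k _ => ?_
    refine (ContinuousLinearMap.le_opNorm _ _).trans ?_
    have h3 := norm_sum_smul_le_of_minSeq_le_one hw1 (ξ k)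
    have h4 : √(sqNorm (ξ k)) ≤ 1 := Real.sqrt_le_one.2 (hξ k)
    calc _ ≤ 1 * ‖φ' k‖ := by gcongr; exact h3.trans h4
      _ ≤ C k := by rw [one_mul]; exact hφ' k
  have hlim : Filter.Tendsto (fun ε : ℝ => K * √(1 + ε) * (1 + ε)) (nhdsWithin 0 (Set.Ioi 0))
      (nhds (K * √(1 + 0) * (1 + 0))) :=
    tendsto_nhdsWithin_of_tendsto_nhds (Continuous.tendsto (by fun_prop) 0)
  have := ge_of_tendsto hlim (Filter.eventually_of_mem self_mem_nhdsWithin key)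
  simpa using this

lemma ROW_column_le {n : ℕ} (v : Fin n → E) (b : Fin n) :
    ROW E n (Matrix.of fun i j => if j = b then v i else 0) ≤ minSeq E n v := by
  refine le_of_forall_gt_imp_ge_of_dense fun s hs => ?_
  have hs0 : 0 < s := (minSeq_nonneg v).trans_lt hs
  have hs' : (s : ℂ) ≠ 0 := by exact_mod_cast hs0.ne'
  refine (ROW_le (κ := Fin 1) (ℓ := Fin n) (a := s) (b := 1)
    (Matrix.of fun i q => if i = q.2 then (s : ℂ) else 0) (fun _ p => (s : ℂ)⁻¹ • v p)
    (Matrix.of fun _ j => if j = b then 1 else 0) (fun _ ξ => ?_) (fun i j => ?_) ?_ ?_).trans_eq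
      (mul_one s)
  · simp only [smul_comm (ξ _), ← Finset.smul_sum]
    rw [norm_smul, norm_inv, Complex.norm_real, Real.norm_of_nonneg hs0.le, inv_mul_le_iff₀ hs0]
    exact (norm_sum_smul_le_minSeq v ξ).trans (by gcongr)
  · by_cases hj : j = b <;> simp [hj, smul_smul, hs']
  · refine norm_le_of_vecMul hs0.le fun ξ => ?_
    simp [sqNorm, Fintype.sum_prod_type, mul_pow, Finset.mul_sum, mul_comm]
  · refine norm_le_of_mulVec zero_le_one fun ξ => ?_
    have : ‖ξ b‖ ^ 2 ≤ sqNorm ξ :=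
      Finset.single_le_sum (f := fun i => ‖ξ i‖ ^ 2) (fun _ _ => sq_nonneg _) (Finset.mem_univ b)
    simpa [sqNorm] using this

/-- By `maxSeq_dual_le` the column `f ξ` need only be tested against `c` and `v`. The test is `f` at
the matrix with the single nonzero column `v`, between the vectors `c` and `e_b ⊗ ξ`. -/
lemma COL_le_dual_ROW {n : ℕ} (f : Matrix (Fin n) (Fin n) (StrongDual ℂ E)) :
    COL (StrongDual ℂ E) n f ≤ dual (ROW E) n f := by
  have hD : 0 ≤ dual (ROW E) n f := ENNReal.toReal_nonneg
  refine COL_le hD fun ξ => ?_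
  refine maxSeq_dual_le _ (by positivity) fun c v => ?_
  rcases Nat.eq_zero_or_pos n with rfl | hn
  · simp
  · let b : Fin n := ⟨0, hn⟩
    -- The opposite inequality supplies the finiteness of the completely bounded norm.
    have h1 := norm_sum_le_dual isOperatorSpace_ROW
      ((cbNorm_ROW_le n f).trans_lt ENNReal.ofReal_lt_top).ne (fun _ => ROW_nonneg)
      (Matrix.of fun i j => if j = b then v i else 0) (fun q => c q.2 q.1)
      (fun q => if q.1 = b then ξ q.2 else 0)
    have e1 : sqNorm (fun q : Fin n × Fin n => c q.2 q.1) = ∑ i, ∑ j, ‖c i j‖ ^ 2 := by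
      rw [sqNorm_prod (fun i j => c j i), Finset.sum_comm]
    have e2 : sqNorm (fun q : Fin n × Fin n => if q.1 = b then ξ q.2 else 0) = sqNorm ξ := by
      rw [sqNorm, Fintype.sum_prod_type, Finset.sum_eq_single b] <;> simp +contextual [sqNorm]
    have e3 : ∑ q : Fin n × Fin n, ∑ r : Fin n × Fin n, c q.2 q.1 * f q.2 r.2
        ((Matrix.of fun i j => if j = b then v i else 0) q.1 r.1) * (if r.1 = b then ξ r.2 else 0)
        = ∑ i, ∑ j, c i j * (∑ k, ξ k • f i k) (v j) := by
      rw [Fintype.sum_prod_type_right]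
      refine Finset.sum_congr rfl fun i _ => Finset.sum_congr rfl fun j _ => ?_
      rw [Fintype.sum_prod_type, Finset.sum_eq_single b]
      · simp only [Matrix.of_apply, if_true, sum_apply, smul_apply, smul_eq_mul, Finset.mul_sum]
        exact Finset.sum_congr rfl fun k _ => by ring
      · intro a _ ha
        simp [ha]
      · simp
    rw [e1, e2, e3] at h1
    refine h1.trans ?_
    have h2 := ROW_column_le v b
    calc _ ≤ dual (ROW E) n f * minSeq E n v * √(∑ i, ∑ j, ‖c i j‖ ^ 2) * √(sqNorm ξ) := by gcongr
      _ = _ := by ring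

lemma ROW_smul {n : ℕ} (c : ℂ) (x : Matrix (Fin n) (Fin n) E) :
    ROW E n (c • x) = ‖c‖ * ROW E n x := isOperatorSpace_ROW.homog n c x

lemma exists_functional_of_ROW {n : ℕ} (x : Matrix (Fin n) (Fin n) E) :
    ∃ Φ : Matrix (Fin n) (Fin n) E →ₗ[ℂ] ℂ, (∀ y, ‖Φ y‖ ≤ ROW E n y) ∧ ROW E n x ≤ (Φ x).re :=
  exists_functional_of_seminorm (ROW E n) ROW_add ROW_smul x

lemma ROW_le_dual_COL {n : ℕ} (f : Matrix (Fin n) (Fin n) (StrongDual ℂ E)) :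
    ROW (StrongDual ℂ E) n f ≤ dual (COL E) n f := by
  obtain ⟨Φ, hΦ, hf⟩ := exists_functional_of_ROW f
  refine hf.trans ?_
  set K := dual (COL E) n f with hKdef
  have hK : 0 ≤ K := ENNReal.toReal_nonneg
  have key : ∀ ε : ℝ, 0 < ε → (Φ f).re ≤ K * (1 + ε) * (1 + ε) + ε := by
    intro ε hε
    obtain ⟨r, r', s, s', hr, hs, hrHS, hsHS, hle⟩ := exists_two_sided_factorization Φ hΦ hε
    -- This is the amplified `f` evaluated between the vectors `r` and `s`, whose norms are at most
    -- `√(1 + ε)`. The argument `x` lists the columns of a matrix, hence the transposed indices.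
    let hfun : (Fin n → Fin n → E) →ₗ[ℂ] ℂ :=
      ∑ q : Fin n × Fin n, ∑ u : Fin n × Fin n, (r q.1 q.2 * s u.1 u.2) •
        ((f q.2 u.2 : E →ₗ[ℂ] ℂ) ∘ₗ (LinearMap.proj q.1 : (Fin n → E) →ₗ[ℂ] E)
          ∘ₗ (LinearMap.proj u.1 : (Fin n → Fin n → E) →ₗ[ℂ] (Fin n → E)))
    have hfun_apply : ∀ x, hfun x = ∑ q : Fin n × Fin n, ∑ u : Fin n × Fin n,
        r q.1 q.2 * f q.2 u.2 ((Matrix.of fun i j => x j i) q.1 u.1) * s u.1 u.2 := fun x => by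
      simp only [hfun, LinearMap.sum_apply, LinearMap.smul_apply, smul_eq_mul]
      refine Finset.sum_congr rfl fun q _ => Finset.sum_congr rfl fun u _ => ?_
      simp only [LinearMap.comp_apply, LinearMap.proj_apply, Matrix.of_apply,
        ContinuousLinearMap.coe_coe]
      ring
    obtain ⟨κ, _, ξ, φ, C, hC0, hξ, hφ, hCsum, hrep⟩ := exists_nuclear_representation
      (maxSeminorm E n) hfun (K := K * (1 + ε)) (by positivity) hε (by
        intro x t ht hx
        rw [hfun_apply]
        have h1 := norm_sum_le_dual isOperatorSpace_COL
          ((cbNorm_COL_le n f).trans_lt ENNReal.ofReal_lt_top).ne (fun _ => COL_nonneg)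
          (Matrix.of fun i j => x j i) (fun q => r q.1 q.2) (fun q => s q.1 q.2)
        have h2 : COL E n (Matrix.of fun i j => x j i) ≤ t := COL_le ht fun η => by
          have e : (fun i => ∑ k, η k • (Matrix.of fun i j => x j i) i k) = ∑ k, η k • x k := by
            ext i; simp
          rw [e]
          exact hx η
        refine h1.trans ?_
        rw [sqNorm_prod r, sqNorm_prod s]
        have h3 := Real.sqrt_le_sqrt hrHS
        have h4 := Real.sqrt_le_sqrt hsHS
        calc _ ≤ K * t * √(1 + ε) * √(1 + ε) := by gcongr
          _ = K * t * (√(1 + ε) * √(1 + ε)) := by ring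
          _ = _ := by rw [Real.mul_self_sqrt (by positivity)]; ring)
    set δ : ℝ := ε / (Fintype.card κ + 1) with hδ
    have hδ0 : 0 < δ := by positivity
    -- The slack `δ²` gives `C² + δ² ≤ (C + δ)²`, and the errors `δ` add up to at most `ε`.
    choose c v hcv hc hv using fun k =>
      exists_factorization_of_le_maxSeq (φ k) (hC0 k) (pow_pos hδ0 2) (hφ k)
    have hcoef : ∀ i j, ∑ a, ∑ b, (r i a * s j b) • f a b
        = ∑ k, ξ k j • ∑ p, c k i p • v k p := by
      intro i j
      ext e
      have h1 := hrep (Pi.single j (Pi.single i e))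
      have h2 : hfun (Pi.single j (Pi.single i e)) = ∑ a, ∑ b, r i a * s j b * f a b e := by
        rw [hfun_apply, Fintype.sum_prod_type, Finset.sum_eq_single i]
        · refine Finset.sum_congr rfl fun a _ => ?_
          rw [Fintype.sum_prod_type, Finset.sum_eq_single j]
          · refine Finset.sum_congr rfl fun b _ => ?_
            simp only [Matrix.of_apply, Pi.single_eq_same]
            ring
          · intro l _ hl
            simp [Pi.single_eq_of_ne hl]
          · simp
        · intro l _ hl
          refine Finset.sum_eq_zero fun a _ => Finset.sum_eq_zero fun u _ => ?_
          rcases eq_or_ne u.1 j with hu | hu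
          · simp [hu, Pi.single_eq_of_ne hl]
          · simp [Pi.single_eq_of_ne hu]
        · simp
      have h3 : ∀ k, φ k (∑ l, ξ k l • Pi.single (M := fun _ => Fin n → E) j (Pi.single i e) l)
          = ξ k j * ∑ p, c k i p * v k p e := by
        intro k
        rw [Finset.sum_eq_single j]
        · rw [Pi.single_eq_same, map_smul, smul_eq_mul, hcv, Finset.sum_eq_single i]
          · simp
          · intro l _ hl
            simp [Pi.single_eq_of_ne hl]
          · simp
        · intro l _ hl
          rw [Pi.single_eq_of_ne hl, smul_zero]
        · simp
      rw [h2] at h1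
      simp only [h3] at h1
      simpa [sum_apply, smul_apply] using h1
    -- Undoing `r` and `s` decomposes `f` itself into terms on which the two-sided domination bounds
    -- `Φ` by `C k + δ`.
    have hfrep : f = ∑ k, colRow (colMul (r' * c k) (v k)) (s'.mulVec (ξ k)) := by
      ext1 i j
      have h1 := sum_smul_of_mul_eq_one hr hs f i j
      simp only [hcoef] at h1
      rw [← h1, Matrix.sum_apply]
      exact sum_smul_eq_sum_colRow r' s' ξ c v i j
    have hterm : ∀ k, (Φ (colRow (colMul (r' * c k) (v k)) (s'.mulVec (ξ k)))).re ≤ C k + δ :=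
      fun k => hle (c k) (v k) (ξ k) (C k + δ) (add_pos_of_nonneg_of_pos (hC0 k) hδ0) (hv k)
        ((hc k).trans (by nlinarith [hC0 k])) (hξ k)
    have hδsum : (Fintype.card κ : ℝ) * δ ≤ ε := by
      rw [hδ, mul_div_assoc', div_le_iff₀ (by positivity)]
      nlinarith
    calc (Φ f).re = ∑ k, (Φ (colRow (colMul (r' * c k) (v k)) (s'.mulVec (ξ k)))).re := by
          conv_lhs => rw [hfrep]
          rw [map_sum, Complex.re_sum]
      _ ≤ ∑ k, (C k + δ) := Finset.sum_le_sum fun k _ => hterm k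
      _ = ∑ k, C k + Fintype.card κ * δ := by
          rw [Finset.sum_add_distrib, Finset.sum_const, Finset.card_univ, nsmul_eq_mul]
      _ ≤ _ := add_le_add hCsum hδsum
  have hlim : Filter.Tendsto (fun ε : ℝ => K * (1 + ε) * (1 + ε) + ε) (nhdsWithin 0 (Set.Ioi 0))
      (nhds (K * (1 + 0) * (1 + 0) + 0)) :=
    tendsto_nhdsWithin_of_tendsto_nhds (Continuous.tendsto (by fun_prop) 0)
  have := ge_of_tendsto hlim (Filter.eventually_of_mem self_mem_nhdsWithin key)
  simpa using this

lemma dual_COL : dual (COL E) = ROW (StrongDual ℂ E) := by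
  funext n f
  exact le_antisymm (ENNReal.toReal_le_of_le_ofReal (ROW_nonneg f) (cbNorm_COL_le n f))
    (ROW_le_dual_COL f)

lemma dual_ROW : dual (ROW E) = COL (StrongDual ℂ E) := by
  funext n f
  exact le_antisymm (ENNReal.toReal_le_of_le_ofReal (COL_nonneg f) (cbNorm_ROW_le n f))
    (COL_le_dual_ROW f)

end DualNorms

end OpSpace

theorem mainTheorem8 (E : Type*) [NormedAddCommGroup E] [NormedSpace ℂ E] [CompleteSpace E] :
    (OpSpace.IsOperatorSpace (OpSpace.COL E) ∧ OpSpace.IsHomogeneous (OpSpace.COL E)) ∧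
    (OpSpace.IsOperatorSpace (OpSpace.ROW E) ∧ OpSpace.IsHomogeneous (OpSpace.ROW E)) ∧
    OpSpace.dual (OpSpace.COL E) = OpSpace.ROW (StrongDual ℂ E) ∧
    OpSpace.dual (OpSpace.ROW E) = OpSpace.COL (StrongDual ℂ E) :=
  ⟨⟨OpSpace.isOperatorSpace_COL, OpSpace.isHomogeneous_COL⟩,
    ⟨OpSpace.isOperatorSpace_ROW, OpSpace.isHomogeneous_ROW⟩, OpSpace.dual_COL, OpSpace.dual_ROW⟩
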